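/- Let $E$ be a finite-dimensional real inner product space (for instance $\mathbb{R}^{N\times N}$) and let $\Gamma:E\to(-\infty,+\infty]$ be a function of Legendre type with domain $\mathcal{D}=\operatorname{dom}\Gamma=\{\Gamma\neq+\infty\}$: $\Gamma$ is proper, convex and lower semicontinuous, $\operatorname{int}\mathcal{D}\neq\emptyset$, $\Gamma$ is differentiable and strictly convex on $\operatorname{int}\mathcal{D}$, and $\|\nabla\Gamma(y)\|\to+\infty$ as $y\in\operatorname{int}\mathcal{D}$ tends to a boundary point of $\mathcal{D}$. Let $\Gamma^*(\rho)=\sup_{\pi\in\mathcal{D}}\langle\pi,\rho\rangle-\Gamma(\pi)$, and assume that this supremum is a maximum for every $\rho\in\operatorname{dom}\Gamma^*$ (this holds in particular if $\Gamma^*$ is finite everywhere). For $\pi\in\mathcal{D}$ and $\xi\in\operatorname{int}\mathcal{D}$ put $$D_\Gamma(\pi|\xi)=\Gamma(\pi)-\Gamma(\xi)-\langle\nabla\Gamma(\xi),\pi-\xi\rangle .$$ Let $\phi_1,\phi_2:\mathcal{D}\to(-\infty,+\infty]$ be proper, lower-semicontinuous, convex functions, $\operatorname{dom}\phi_i=\{\pi\in\mathcal{D}:\phi_i(\pi)\neq+\infty\}$,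 such that $$\operatorname{ri}(\operatorname{dom}\phi_1)\cap\operatorname{ri}(\operatorname{dom}\phi_2)\cap\operatorname{ri}(\operatorname{dom}\Gamma)\neq\emptyset ,$$ where $\operatorname{ri}$ is the relative interior, and let $\xi\in\operatorname{int}\mathcal{D}$. Bregman–Dykstra iterates are sequences $(\pi^{(\ell)},v^{(\ell)})_{\ell\ge0}$ with $\pi^{(0)}=\xi$, $v^{(0)}=v^{(-1)}=0$ and, for $\ell\ge1$, $$\pi^{(\ell)}\in\operatorname*{argmin}_{\pi\in\mathcal{D}}\; D_\Gamma\bigl(\pi\,\big|\,\nabla\Gamma^*(\nabla\Gamma(\pi^{(\ell-1)})+v^{(\ell-2)})\bigr)+\phi_{[\ell]_2}(\pi),\qquad v^{(\ell)}=v^{(\ell-2)}+\nabla\Gamma(\pi^{(\ell-1)})-\nabla\Gamma(\pi^{(\ell)}),$$ where $[\ell]_2=1$ for odd $\ell$ and $[\ell]_2=2$ for even $\ell$, and where it is understood that $\nabla\Gamma(\pi^{(\ell-1)})+v^{(\ell-2)}\in\operatorname{int}(\operatorname{dom}\Gamma^*)$ and that the minimizer exists. Then: 1. If $\Gamma^*$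 is finite everywhere, such iterates exist. 2. There is at most one such pair of sequences. 3. Whenever the iterates exist, $\pi^{(\ell)}\in\operatorname{int}\mathcal{D}$ for all $\ell$, the problem $\min_{\pi\in\mathcal{D}}D_\Gamma(\pi|\xi)+\phi_1(\pi)+\phi_2(\pi)$ has exactly one solution $\pi^\star$, and $\pi^{(\ell)}\to\pi^\star$ as $\ell\to\infty$. -/

import Mathlib

open Set Filter Topology

noncomputable section

namespace BregmanDykstra

variable {E : Type*} [NormedAddCommGroup E] [InnerProductSpace ℝ E]

/-- The effective domain of an extended-real-valued function. -/
def dom (f : E → EReal) : Set E := {x | f x ≠ ⊤}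

/-- The effective domain of a function `φ` that is only regarded on the set `S`. -/
def domOn (S : Set E) (φ : E → EReal) : Set E := {x | x ∈ S ∧ φ x ≠ ⊤}

/-- `φ`, regarded as a function on `S` only, is a proper lower-semicontinuous convex function
`S → (-∞, +∞]`; convexity is convexity of the epigraph. -/
structure IsProperConvexLscOn (S : Set E) (φ : E → EReal) : Prop where
  ne_bot : ∀ x ∈ S, φ x ≠ ⊥
  nonempty : (domOn S φ).Nonempty
  convex : Convex ℝ {p : E × ℝ | p.1 ∈ S ∧ φ p.1 ≤ (p.2 : EReal)}
  lsc : LowerSemicontinuousOn φ S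

/-- The Legendre transform `Γ*(ρ) = sup_π ⟪π, ρ⟫ - Γ(π)` (points outside `dom Γ`
contribute `-∞`). -/
def conj (Γ : E → EReal) (ρ : E) : EReal :=
  ⨆ x : E, ((inner ℝ x ρ : ℝ) : EReal) - Γ x

variable [CompleteSpace E]

/-- The gradient of an extended-real-valued function; it is only used at interior points of the
effective domain, where the functions at hand are finite and differentiable. -/
def grad (f : E → EReal) (x : E) : E := gradient (fun y => (f y).toReal) x

/-- Functions of Legendre type: proper, lower semicontinuous and convex, with an effective
domain with nonempty interior, differentiable and strictly convex on that interior, and with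
gradients that blow up at the boundary. -/
structure IsLegendre (Γ : E → EReal) : Prop where
  properConvexLsc : IsProperConvexLscOn Set.univ Γ
  interior_nonempty : (interior (dom Γ)).Nonempty
  differentiable : ∀ x ∈ interior (dom Γ), DifferentiableAt ℝ (fun y => (Γ y).toReal) x
  strictConvex : StrictConvexOn ℝ (interior (dom Γ)) (fun y => (Γ y).toReal)
  blowup : ∀ x ∈ frontier (dom Γ),
    Tendsto (fun y => ‖grad Γ y‖) (𝓝[interior (dom Γ)] x) atTop

/-- The supremum that defines `Γ*` is a maximum at every point where it is finite. -/
def ConjIsMax (Γ : E → EReal) : Prop :=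
  ∀ ρ ∈ dom (conj Γ), ∃ x ∈ dom Γ, conj Γ ρ = ((inner ℝ x ρ : ℝ) : EReal) - Γ x

/-- The Bregman divergence `D_Γ(π|ξ)`, for `ξ` in the interior of `dom Γ`. -/
def bregman (Γ : E → EReal) (x ξ : E) : EReal :=
  Γ x - Γ ξ - ((inner ℝ (grad Γ ξ) (x - ξ) : ℝ) : EReal)

/-- `x` is a minimizer over `dom Γ` of `D_Γ(·|p) + φ`. -/
def IsBregmanProx (Γ φ : E → EReal) (p x : E) : Prop :=
  x ∈ dom Γ ∧ ∀ y ∈ dom Γ, bregman Γ x p + φ x ≤ bregman Γ y p + φ y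

/-- `x` is a minimizer over `dom Γ` of `D_Γ(·|ξ) + φ₁ + φ₂`. -/
def IsSolution (Γ φ₁ φ₂ : E → EReal) (ξ x : E) : Prop :=
  x ∈ dom Γ ∧ ∀ y ∈ dom Γ,
    bregman Γ x ξ + φ₁ x + φ₂ x ≤ bregman Γ y ξ + φ₁ y + φ₂ y

/-- `lag v n` is `v^(n-1)`, with the convention `v^(-1) = 0`. -/
def lag (v : ℕ → E) : ℕ → E
  | 0 => 0
  | n + 1 => v n

/-- `φ_{[ℓ]₂}`: the first function at odd steps, the second one at even steps. -/
def alternate (φ₁ φ₂ : E → EReal) (l : ℕ) : E → EReal :=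
  if Odd l then φ₁ else φ₂

/-- `(x, v)` is a sequence of Bregman–Dykstra iterates started at `ξ`. The step from `n` to
`ℓ = n + 1` uses `x^(ℓ-1) = x n` and `v^(ℓ-2) = lag v n`. The field `mem` says that the point at
which the formula evaluates the gradient of `Γ*` lies where that gradient is defined. -/
structure IsDykstra (Γ φ₁ φ₂ : E → EReal) (ξ : E) (x v : ℕ → E) : Prop where
  x_zero : x 0 = ξ
  v_zero : v 0 = 0
  mem : ∀ n, grad Γ (x n) + lag v n ∈ interior (dom (conj Γ))
  x_succ : ∀ n, IsBregmanProx Γ (alternate φ₁ φ₂ (n + 1))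
    (grad (conj Γ) (grad Γ (x n) + lag v n)) (x (n + 1))
  v_succ : ∀ n, v (n + 1) = lag v n + grad Γ (x n) - grad Γ (x (n + 1))

end BregmanDykstra

end

/-! Write D for the divergence. Optimality of each step makes v^(ℓ) a subgradient of its φ at π^(ℓ),
and the updates conserve ∇Γ(π^(ℓ)) + v^(ℓ) + v^(ℓ-1) = ∇Γ(ξ). This becomes the optimality condition
of the full problem as soon as odd and even iterates share a limit.

For a point z of the three relative interiors, the energy D(z|π^(2k)) plus the linearization gaps of
φ₁ and φ₂ at z decreases, by at least D(π^(2k+2)|π^(2k+1)) from one k to the next (`linGap_step`,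
`dykstra_energy`). So these divergences tend to 0 and D(z|π^(ℓ)) stays bounded. Since Γ is bounded
above near z, the gradients are then bounded; the same argument inside the affine span of each
domain bounds the projected corrections (`exists_projected_subgradient`).

Along a subsequence everything converges. Attainment in the conjugate puts the limit of the
gradients in the range of ∇Γ, whose inverse is continuous, so the iterates converge to an interior
point, which solves the problem (`dykstra_subseq`). Strict convexity makes the solution unique,
hence the whole sequence converges.

Blow-up of ∇Γ keeps all minimizers in the interior; if Γ* is finite everywhere, Γ grows
superlinearly and the minimizers exist. -/

open scoped RealInnerProductSpace

namespace BregmanDykstra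

/-! ### Legendre functions: gradient bounds and interior minimizers. -/

section Real

variable {E : Type*} [NormedAddCommGroup E] [InnerProductSpace ℝ E]

/-- `f` is convex on `C ⊆ S` and, extended by `+∞`, sequentially lower semicontinuous on `S`. -/
structure IsClosedConvexOn (S C : Set E) (f : E → ℝ) : Prop where
  subset : C ⊆ S
  convexOn : ConvexOn ℝ C f
  closed : ∀ (u : ℕ → E) (c : ℕ → ℝ) (x : E) (a : ℝ), (∀ n, u n ∈ C) → x ∈ S →
    Tendsto u atTop (𝓝 x) → Tendsto c atTop (𝓝 a) → (∀ n, f (u n) ≤ c n) → x ∈ C ∧ f x ≤ a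

theorem IsProperConvexLscOn.toReal_closedConvexOn {S : Set E} {φ : E → EReal}
    (h : IsProperConvexLscOn S φ) :
    IsClosedConvexOn S (domOn S φ) (fun x => (φ x).toReal) := by
  have coe : ∀ x ∈ domOn S φ, (((φ x).toReal : ℝ) : EReal) = φ x := fun x hx =>
    EReal.coe_toReal hx.2 (h.ne_bot x hx.1)
  have conv : ∀ x ∈ domOn S φ, ∀ y ∈ domOn S φ, ∀ a b : ℝ, 0 ≤ a → 0 ≤ b → a + b = 1 →
      a • x + b • y ∈ S ∧
        φ (a • x + b • y) ≤ ((a • (φ x).toReal + b • (φ y).toReal : ℝ) : EReal) := by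
    intro x hx y hy a b ha hb hab
    exact h.convex (x := (x, (φ x).toReal)) ⟨hx.1, (coe x hx).ge⟩
      (y := (y, (φ y).toReal)) ⟨hy.1, (coe y hy).ge⟩ ha hb hab
  have conv' : ∀ x ∈ domOn S φ, ∀ y ∈ domOn S φ, ∀ a b : ℝ, 0 ≤ a → 0 ≤ b → a + b = 1 →
      a • x + b • y ∈ domOn S φ := by
    intro x hx y hy a b ha hb hab
    obtain ⟨h1, h2⟩ := conv x hx y hy a b ha hb hab
    exact ⟨h1, ne_top_of_le_ne_top (EReal.coe_ne_top _) h2⟩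
  refine ⟨fun x hx => hx.1, ⟨?_, ?_⟩, ?_⟩
  · intro x hx y hy a b ha hb hab
    exact conv' x hx y hy a b ha hb hab
  · intro x hx y hy a b ha hb hab
    have h2 := (conv x hx y hy a b ha hb hab).2
    rw [← coe _ (conv' x hx y hy a b ha hb hab)] at h2
    exact EReal.coe_le_coe_iff.1 h2
  · intro u c x a hu hx hux hc hle
    have key : φ x ≤ (a : EReal) := by
      by_contra hlt
      rw [not_le] at hlt
      obtain ⟨b, hab, hb⟩ := EReal.lt_iff_exists_real_btwn.1 hlt
      have h1 : ∀ᶠ y in 𝓝[S] x, (b : EReal) < φ y := h.lsc x hx b hb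
      have h2 : Tendsto u atTop (𝓝[S] x) :=
        tendsto_nhdsWithin_iff.2 ⟨hux, Eventually.of_forall fun n => (hu n).1⟩
      have h3 : ∀ᶠ n in atTop, b ≤ c n := by
        filter_upwards [h2.eventually h1] with n hn
        rw [← coe _ (hu n)] at hn
        exact (EReal.coe_lt_coe_iff.1 hn).le.trans (hle n)
      exact absurd (ge_of_tendsto hc h3) (not_le.2 (EReal.coe_lt_coe_iff.1 hab))
    have hxC : x ∈ domOn S φ := ⟨hx, ne_top_of_le_ne_top (EReal.coe_ne_top _) key⟩
    rw [← coe x hxC] at key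
    exact ⟨hxC, EReal.coe_le_coe_iff.1 key⟩

theorem add_smul_le_of_convexOn {C : Set E} {f : E → ℝ} (hf : ConvexOn ℝ C f) {x y : E}
    (hx : x ∈ C) (hy : y ∈ C) {t : ℝ} (h0 : 0 ≤ t) (h1 : t ≤ 1) :
    x + t • (y - x) ∈ C ∧ f (x + t • (y - x)) ≤ f x + t * (f y - f x) := by
  have e : x + t • (y - x) = (1 - t) • x + t • y := by module
  rw [e]
  refine ⟨hf.1 hx hy (by linarith) h0 (by ring), ?_⟩
  have := hf.2 hx hy (by linarith : 0 ≤ 1 - t) h0 (by ring)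
  simp only [smul_eq_mul] at this
  linarith

section Complete

variable [CompleteSpace E]

theorem inner_le_of_hasGradientAt {f : E → ℝ} {v x d : E} {c : ℝ} (h : HasGradientAt f v x)
    (hc : ∀ t : ℝ, 0 < t → t ≤ 1 → f (x + t • d) ≤ f x + t * c) : ⟪v, d⟫ ≤ c := by
  have h1 := (h.hasFDerivAt.hasLineDerivAt d).tendsto_slope_zero_right
  simp only [InnerProductSpace.toDual_apply_apply] at h1
  refine le_of_tendsto h1 ?_
  filter_upwards [Ioc_mem_nhdsGT (zero_lt_one' ℝ)] with t ht
  have := hc t ht.1 ht.2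
  rw [smul_eq_mul, inv_mul_le_iff₀ ht.1]
  linarith

theorem le_inner_of_hasGradientAt {f : E → ℝ} {v x d : E} {c : ℝ} (h : HasGradientAt f v x)
    (hc : ∀ t : ℝ, 0 < t → t ≤ 1 → f x + t * c ≤ f (x + t • d)) : c ≤ ⟪v, d⟫ := by
  have h1 := (h.hasFDerivAt.hasLineDerivAt d).tendsto_slope_zero_right
  simp only [InnerProductSpace.toDual_apply_apply] at h1
  refine ge_of_tendsto h1 ?_
  filter_upwards [Ioc_mem_nhdsGT (zero_lt_one' ℝ)] with t ht
  have := hc t ht.1 ht.2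
  rw [smul_eq_mul, le_inv_mul_iff₀ ht.1]
  linarith

/-- Real-valued form of `IsLegendre`: `D` is the effective domain, `g` the function on it and `g'`
its gradient. -/
structure IsLegendreReal (D : Set E) (g : E → ℝ) (g' : E → E) : Prop where
  closedConvex : IsClosedConvexOn univ D g
  hasGradientAt : ∀ x ∈ interior D, HasGradientAt g (g' x) x
  strictConvexOn : StrictConvexOn ℝ (interior D) g
  blowup : ∀ x ∈ frontier D, Tendsto (fun y => ‖g' y‖) (𝓝[interior D] x) atTop

namespace IsLegendreReal

variable {D : Set E} {g : E → ℝ} {g' : E → E} (h : IsLegendreReal D g g')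
include h

theorem gradient_le {x y : E} (hx : x ∈ interior D) (hy : y ∈ D) :
    g x + ⟪g' x, y - x⟫ ≤ g y := by
  have := inner_le_of_hasGradientAt (h.hasGradientAt x hx) (d := y - x) (c := g y - g x) fun t h0 h1 =>
    (add_smul_le_of_convexOn h.closedConvex.convexOn (interior_subset hx) hy h0.le h1).2
  linarith

theorem gradient_lt {x y : E} (hx : x ∈ interior D) (hy : y ∈ interior D) (hne : x ≠ y) :
    g x + ⟪g' x, y - x⟫ < g y := by
  have hm : (1 / 2 : ℝ) • x + (1 / 2 : ℝ) • y ∈ D :=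
    h.closedConvex.convexOn.1 (interior_subset hx) (interior_subset hy) (by norm_num)
      (by norm_num) (by norm_num)
  have h1 := h.gradient_le hx hm
  have h2 := h.strictConvexOn.2 hx hy hne (by norm_num : (0 : ℝ) < 1 / 2)
    (by norm_num : (0 : ℝ) < 1 / 2) (by norm_num)
  have e : (1 / 2 : ℝ) • x + (1 / 2 : ℝ) • y - x = (1 / 2 : ℝ) • (y - x) := by module
  rw [e, real_inner_smul_right] at h1
  simp only [smul_eq_mul] at h2
  linarith

/-- As g is bounded by M on a ball of radius r about z, the gradient inequality at x can be tested
at the point of that ball farthest in the direction g' x. A bound on the divergence from x to z thus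
bounds the gradient at x. -/
theorem exists_norm_gradient_le {z : E} (hz : z ∈ interior D) :
    ∃ r > 0, ∃ M : ℝ, ∀ x ∈ interior D, r * ‖g' x‖ ≤ M - g x - ⟪g' x, z - x⟫ := by
  have hc := (h.hasGradientAt z hz).differentiableAt.continuousAt
  have h1 : ∀ᶠ y in 𝓝 z, y ∈ D ∧ g y < g z + 1 :=
    Filter.Eventually.and (mem_interior_iff_mem_nhds.1 hz)
      (hc.eventually (gt_mem_nhds (by linarith)))
  obtain ⟨r, hr, hb⟩ := Metric.nhds_basis_closedBall.eventually_iff.1 h1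
  refine ⟨r, hr, g z + 1, fun x hx => ?_⟩
  rcases eq_or_ne (g' x) 0 with h0 | h0
  · have := h.gradient_le hx (interior_subset hz)
    simp only [h0, inner_zero_left, norm_zero, mul_zero] at *
    linarith
  · have hn : 0 < ‖g' x‖ := norm_pos_iff.2 h0
    obtain ⟨hD, hM⟩ := hb (x := z + (r / ‖g' x‖) • g' x) (by
      rw [Metric.mem_closedBall, dist_eq_norm, add_sub_cancel_left, norm_smul, Real.norm_eq_abs,
        abs_of_pos (by positivity), div_mul_cancel₀ _ hn.ne'])
    have h2 := h.gradient_le hx hD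
    have e : z + (r / ‖g' x‖) • g' x - x = (z - x) + (r / ‖g' x‖) • g' x := by module
    rw [e, inner_add_right, real_inner_smul_right, real_inner_self_eq_norm_sq] at h2
    have e2 : r / ‖g' x‖ * ‖g' x‖ ^ 2 = r * ‖g' x‖ := by field_simp
    linarith

/-- Blow-up concerns only the norm of the gradient; `exists_norm_gradient_le` turns it into a slope
tending to -∞ along the segment from x to z. -/
theorem exists_inner_gradient_lt {x z : E} (hx : x ∈ D) (hx' : x ∉ interior D)
    (hz : z ∈ interior D) (c : ℝ) :
    ∃ t : ℝ, 0 < t ∧ t ≤ 1 ∧ x + t • (z - x) ∈ interior D ∧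
      ⟪g' (x + t • (z - x)), z - x⟫ < c := by
  obtain ⟨r, hr, M, hM⟩ := h.exists_norm_gradient_le hz
  have hfr : x ∈ frontier D := ⟨subset_closure hx, hx'⟩
  have hmem : ∀ t ∈ Ioc (0 : ℝ) 1, x + t • (z - x) ∈ interior D := fun t ht =>
    h.closedConvex.convexOn.1.add_smul_sub_mem_interior hx hz ht
  have hlim : Tendsto (fun t : ℝ => x + t • (z - x)) (𝓝[>] 0) (𝓝[interior D] x) := by
    refine tendsto_nhdsWithin_iff.2 ⟨?_, ?_⟩
    · have : Continuous fun t : ℝ => x + t • (z - x) := by fun_prop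
      simpa using (this.tendsto 0).mono_left nhdsWithin_le_nhds
    · filter_upwards [Ioc_mem_nhdsGT (zero_lt_one' ℝ)] with t ht using hmem t ht
  -- The first two terms absorb M - g p, where g p is bounded below by the tangent at z; the rest
  -- leaves a slope below c.
  set B : ℝ := |M - g z| + |⟪g' z, z - x⟫| + |c| + 1 with hB
  have hev : ∀ᶠ t in 𝓝[>] (0 : ℝ), B / r ≤ ‖g' (x + t • (z - x))‖ :=
    ((h.blowup x hfr).comp hlim).eventually_ge_atTop (B / r)
  obtain ⟨t, ht, ht0, ht1⟩ := (hev.and (Ioo_mem_nhdsGT (zero_lt_one' ℝ))).exists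
  refine ⟨t, ht0, ht1.le, hmem t ⟨ht0, ht1.le⟩, ?_⟩
  set p := x + t • (z - x) with hp
  have hpD : p ∈ interior D := hmem t ⟨ht0, ht1.le⟩
  have h1 := hM p hpD
  have h2 := h.gradient_le hz (interior_subset hpD)
  have e1 : z - p = (1 - t) • (z - x) := by rw [hp]; module
  have e2 : p - z = -((1 - t) • (z - x)) := by rw [hp]; module
  rw [e1, real_inner_smul_right] at h1
  rw [e2, inner_neg_right, real_inner_smul_right] at h2
  rw [div_le_iff₀ hr, mul_comm] at ht
  have h3 : (1 - t) * ⟪g' z, z - x⟫ ≤ |⟪g' z, z - x⟫| := by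
    calc (1 - t) * ⟪g' z, z - x⟫ ≤ (1 - t) * |⟪g' z, z - x⟫| := by
          refine mul_le_mul_of_nonneg_left ?_ (by linarith)
          exact le_abs_self _
      _ ≤ 1 * |⟪g' z, z - x⟫| := by gcongr; linarith
      _ = _ := one_mul _
  have h4 : (1 - t) * ⟪g' p, z - x⟫ ≤ -(|c| + 1) := by
    have := le_abs_self (M - g z)
    linarith
  have h5 : ⟪g' p, z - x⟫ < 0 := by
    by_contra hcon
    have : 0 ≤ (1 - t) * ⟪g' p, z - x⟫ := mul_nonneg (by linarith) (not_lt.1 hcon)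
    have := abs_nonneg c
    linarith
  have h6 : t * ⟪g' p, z - x⟫ ≤ 0 := mul_nonpos_of_nonneg_of_nonpos ht0.le h5.le
  have := neg_abs_le c
  linarith

theorem mem_interior_of_isMin {C : Set E} {f : E → ℝ} (hC : C ⊆ D) (hf : ConvexOn ℝ C f)
    {ρ x z : E} (hx : x ∈ C) (hz : z ∈ C) (hzD : z ∈ interior D)
    (hmin : ∀ y ∈ C, g x - ⟪ρ, x⟫ + f x ≤ g y - ⟪ρ, y⟫ + f y) : x ∈ interior D := by
  by_contra hx'
  -- The threshold is the slope at which the decrease of g towards z outweighs the linear term and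
  -- the chord of f, contradicting minimality.
  obtain ⟨t, h0, h1, hp, hlt⟩ := h.exists_inner_gradient_lt (hC hx) hx' hzD
    (⟪ρ, z - x⟫ - (f z - f x))
  set p := x + t • (z - x) with hpdef
  obtain ⟨hpC, hfp⟩ := add_smul_le_of_convexOn hf hx hz h0.le h1
  have h2 := hmin p hpC
  have h3 := h.gradient_le hp (hC hx)
  have e1 : x - p = -(t • (z - x)) := by rw [hpdef]; module
  rw [e1, inner_neg_right, real_inner_smul_right] at h3
  have e2 : ⟪ρ, p⟫ = ⟪ρ, x⟫ + t * ⟪ρ, z - x⟫ := by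
    rw [hpdef, inner_add_right, real_inner_smul_right]
  have h4 : t * ⟪g' p, z - x⟫ < t * (⟪ρ, z - x⟫ - (f z - f x)) := by gcongr
  rw [mul_sub] at h4
  linarith

theorem subgradient_of_isMin {C : Set E} {f : E → ℝ} (hf : ConvexOn ℝ C f)
    {ρ x : E} (hx : x ∈ C) (hxD : x ∈ interior D)
    (hmin : ∀ y ∈ C, g x - ⟪ρ, x⟫ + f x ≤ g y - ⟪ρ, y⟫ + f y) {y : E} (hy : y ∈ C) :
    f x + ⟪ρ - g' x, y - x⟫ ≤ f y := by
  have := le_inner_of_hasGradientAt (h.hasGradientAt x hxD) (d := y - x) (c := ⟪ρ, y - x⟫ - (f y - f x))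
    fun t h0 h1 => by
      obtain ⟨hpC, hfp⟩ := add_smul_le_of_convexOn hf hx hy h0.le h1
      have h2 := hmin _ hpC
      rw [inner_add_right, real_inner_smul_right] at h2
      linarith
  rw [inner_sub_left]
  linarith

/-- Strict convexity holds only on the interior, so both minimizers must be known to lie there. -/
theorem eq_of_isMin {C : Set E} {f : E → ℝ} (hf : ConvexOn ℝ C f)
    {ρ x x' : E} (hx : x ∈ C) (hxD : x ∈ interior D) (hx' : x' ∈ C) (hxD' : x' ∈ interior D)
    (hmin : ∀ y ∈ C, g x - ⟪ρ, x⟫ + f x ≤ g y - ⟪ρ, y⟫ + f y)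
    (hmin' : ∀ y ∈ C, g x' - ⟪ρ, x'⟫ + f x' ≤ g y - ⟪ρ, y⟫ + f y) : x = x' := by
  by_contra hne
  have h1 := h.subgradient_of_isMin hf hx hxD hmin hx'
  have h2 := h.gradient_lt hxD hxD' hne
  have h3 := hmin' x hx
  rw [inner_sub_left] at h1
  have e : ⟪ρ, x' - x⟫ = ⟪ρ, x'⟫ - ⟪ρ, x⟫ := inner_sub_right _ _ _
  linarith

end IsLegendreReal

end Complete

end Real

/-! ### Compactness arguments in finite dimension. -/

section Real

variable {E : Type*} [NormedAddCommGroup E] [InnerProductSpace ℝ E] [FiniteDimensional ℝ E]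

/-- Subgradients are uncontrolled orthogonally to the affine span of C, but that component is
invisible on differences of points of C. The projection u onto the direction is bounded as in
`exists_norm_gradient_le`, by testing at z + r u / ‖u‖ in a relative ball on which f is bounded
above. -/
theorem exists_projected_subgradient {C : Set E} {f : E → ℝ} (hf : ConvexOn ℝ C f) {z : E}
    (hz : z ∈ intrinsicInterior ℝ C) :
    ∃ r > 0, ∃ M : ℝ, ∀ v x : E, x ∈ C → (∀ y ∈ C, f x + ⟪v, y - x⟫ ≤ f y) →
      ∃ u : E, (∀ y ∈ C, ∀ y' ∈ C, ⟪u, y - y'⟫ = ⟪v, y - y'⟫) ∧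
        r * ‖u‖ ≤ M - f x - ⟪v, z - x⟫ := by
  set L : Submodule ℝ E := (affineSpan ℝ C).direction with hL
  have hzC : z ∈ C := intrinsicInterior_subset hz
  have hzA : z ∈ affineSpan ℝ C := subset_affineSpan ℝ C hzC
  obtain ⟨y, hy, hyz⟩ := mem_intrinsicInterior.1 hz
  -- Translation by z identifies the direction with the affine span, so the relative interior
  -- becomes an ordinary interior, where a convex function is continuous.
  let ι : L → affineSpan ℝ C := fun d => ⟨(d : E) + z, AffineSubspace.vadd_mem_of_mem_direction d.2 hzA⟩
  have hι : Continuous ι := by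
    refine Continuous.subtype_mk ?_ _
    fun_prop
  have hι0 : ι 0 = y := Subtype.ext (by simp [ι, hyz])
  let A : L →ᵃ[ℝ] E := L.subtype.toAffineMap + AffineMap.const ℝ L z
  have hA : ∀ d : L, A d = (d : E) + z := fun d => by simp [A]
  have hG : ConvexOn ℝ (A ⁻¹' C) (f ∘ A) := hf.comp_affineMap A
  have h0 : (0 : L) ∈ interior (A ⁻¹' C) := by
    rw [mem_interior_iff_mem_nhds]
    have h1 : ι ⁻¹' interior ((↑) ⁻¹' C : Set (affineSpan ℝ C)) ∈ 𝓝 (0 : L) :=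
      hι.continuousAt.preimage_mem_nhds (by rw [hι0]; exact isOpen_interior.mem_nhds hy)
    filter_upwards [h1] with d hd
    have := interior_subset hd
    simpa [hA, ι] using this
  have hcont : ContinuousAt (f ∘ A) 0 :=
    (hG.locallyLipschitzOn_interior.continuousOn).continuousAt (isOpen_interior.mem_nhds h0)
  have hev : ∀ᶠ d : L in 𝓝 0, d ∈ A ⁻¹' C ∧ (f ∘ A) d < (f ∘ A) 0 + 1 :=
    Filter.Eventually.and (mem_interior_iff_mem_nhds.1 h0)
      (hcont.eventually (gt_mem_nhds (by linarith)))
  obtain ⟨r, hr, hb⟩ := Metric.nhds_basis_closedBall.eventually_iff.1 hev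
  refine ⟨r, hr, f z + 1, fun v x hx hv => ⟨L.starProjection v, fun y hy y' hy' => ?_, ?_⟩⟩
  · have hd : y - y' ∈ L := AffineSubspace.vsub_mem_direction (subset_affineSpan ℝ C hy)
      (subset_affineSpan ℝ C hy')
    have := Submodule.starProjection_inner_eq_zero (K := L) v _ hd
    rw [inner_sub_left] at this
    linarith
  · set u := L.starProjection v with hu
    have huL : u ∈ L := Submodule.starProjection_apply_mem L v
    rcases eq_or_ne u 0 with h0 | h0
    · have := hv z hzC
      rw [h0, norm_zero]
      linarith
    · have hn : 0 < ‖u‖ := norm_pos_iff.2 h0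
      let d : L := ⟨(r / ‖u‖) • u, L.smul_mem _ huL⟩
      obtain ⟨hC, hM⟩ := hb (x := d) (by
        rw [mem_closedBall_zero_iff, Submodule.coe_norm, norm_smul, Real.norm_eq_abs,
          abs_of_pos (by positivity), div_mul_cancel₀ _ hn.ne'])
      simp only [mem_preimage, Function.comp, hA, ZeroMemClass.coe_zero, zero_add] at hC hM
      have h2 := hv _ hC
      have e : (d : E) + z - x = (z - x) + (r / ‖u‖) • u := by
        simp only [d]; module
      have e3 : ⟪v, u⟫ = ‖u‖ ^ 2 := by
        have := Submodule.starProjection_inner_eq_zero (K := L) v _ huL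
        rw [inner_sub_left, ← hu, real_inner_self_eq_norm_sq] at this
        linarith
      rw [e, inner_add_right, real_inner_smul_right, e3] at h2
      have e2 : r / ‖u‖ * ‖u‖ ^ 2 = r * ‖u‖ := by field_simp
      linarith

/-- Semicontinuity and compactness bound f below on a ball inside D; convexity along rays from z
extends the bound with linear loss. The ball must lie in D because f is closed only relative to D.
-/
theorem IsClosedConvexOn.exists_lower_bound {D C : Set E} {f : E → ℝ}
    (hf : IsClosedConvexOn D C f) {z : E} (hz : z ∈ C) (hzD : z ∈ interior D) :
    ∃ a b : ℝ, 0 ≤ b ∧ ∀ y ∈ C, a - b * ‖y - z‖ ≤ f y := by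
  obtain ⟨r, hr, hb⟩ := Metric.nhds_basis_closedBall.mem_iff.1 (mem_interior_iff_mem_nhds.1 hzD)
  have hbdd : ∃ m : ℝ, ∀ y ∈ C, y ∈ Metric.closedBall z r → m ≤ f y := by
    by_contra hcon
    push Not at hcon
    choose u huC hub hu using fun n : ℕ => hcon (-(n : ℝ))
    obtain ⟨x, hx, ψ, hψ, hlim⟩ := (isCompact_closedBall z r).tendsto_subseq hub
    have key : ∀ c : ℝ, f x ≤ c := by
      intro c
      obtain ⟨N, hN⟩ := exists_nat_ge (-c)
      -- The shift by N drops the terms at which the bound -ψ(n) might still exceed c.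
      refine (hf.closed (fun n => u (ψ (n + N))) (fun _ => c) x c (fun n => huC _) (hb hx)
        (hlim.comp (tendsto_add_atTop_nat N)) tendsto_const_nhds fun n => ?_).2
      have h1 : ((N : ℕ) : ℝ) ≤ (ψ (n + N) : ℝ) := by
        exact_mod_cast (Nat.le_add_left N n).trans (hψ.id_le _)
      have := hu (ψ (n + N))
      linarith
    linarith [key (f x - 1)]
  obtain ⟨m, hm⟩ := hbdd
  have hmz : m ≤ f z := hm z hz (Metric.mem_closedBall_self hr.le)
  refine ⟨m, (f z - m) / r, div_nonneg (by linarith) hr.le, fun y hy => ?_⟩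
  rcases le_or_gt ‖y - z‖ r with hle | hgt
  · have h1 := hm y hy (by rwa [Metric.mem_closedBall, dist_eq_norm])
    have : 0 ≤ (f z - m) / r * ‖y - z‖ :=
      mul_nonneg (div_nonneg (by linarith) hr.le) (norm_nonneg _)
    linarith
  · have hn : 0 < ‖y - z‖ := hr.trans hgt
    obtain ⟨hC, hle⟩ := add_smul_le_of_convexOn hf.convexOn hz hy
      (t := r / ‖y - z‖) (by positivity) ((div_le_one hn).2 hgt.le)
    have h1 := hm _ hC (by
      rw [Metric.mem_closedBall, dist_eq_norm, add_sub_cancel_left, norm_smul, Real.norm_eq_abs,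
        abs_of_pos (by positivity), div_mul_cancel₀ _ hn.ne'])
    have h2 : m - f z ≤ r / ‖y - z‖ * (f y - f z) := by linarith
    have h3 : (m - f z) * (‖y - z‖ / r) ≤ f y - f z := by
      calc (m - f z) * (‖y - z‖ / r) ≤ (r / ‖y - z‖ * (f y - f z)) * (‖y - z‖ / r) := by
            gcongr
        _ = f y - f z := by field_simp
    have h4 : (f z - m) / r * ‖y - z‖ = -((m - f z) * (‖y - z‖ / r)) := by ring
    linarith

namespace IsLegendreReal

variable {D : Set E} {g : E → ℝ} {g' : E → E} (h : IsLegendreReal D g g')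
include h

/-- The divergence from x is at least some δ > 0 on a sphere of radius r, hence at least δ‖y - x‖/r
beyond it by convexity. It is also at most ⟪g' y - g' x, y - x⟫, so gradients closer than δ/r force
y inside the sphere. -/
theorem gradient_inverse_continuous {x : E} (hx : x ∈ interior D) {ε : ℝ} (hε : 0 < ε) :
    ∃ η > 0, ∀ y ∈ interior D, ‖g' y - g' x‖ < η → ‖y - x‖ < ε := by
  obtain ⟨r₀, hr₀, hb⟩ := Metric.nhds_basis_closedBall.mem_iff.1
    (isOpen_interior.mem_nhds hx)
  set r := min r₀ (ε / 2) with hr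
  have hr0 : 0 < r := lt_min hr₀ (by linarith)
  have hsub : Metric.sphere x r ⊆ interior D := fun y hy => hb
    (Metric.closedBall_subset_closedBall (min_le_left _ _) (Metric.sphere_subset_closedBall hy))
  have hcont : ContinuousOn (fun y => g y - g x - ⟪g' x, y - x⟫) (Metric.sphere x r) := by
    have : ContinuousOn g (Metric.sphere x r) := fun y hy =>
      (h.hasGradientAt y (hsub hy)).differentiableAt.continuousAt.continuousWithinAt
    fun_prop
  obtain ⟨δ, hδ, hδle⟩ := (isCompact_sphere x r).exists_forall_le' hcont (a := 0) (by
    intro y hy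
    have hne : x ≠ y := by
      rintro rfl
      simp [hr0.ne] at hy
    have := h.gradient_lt hx (hsub hy) hne
    linarith)
  refine ⟨δ / r, by positivity, fun y hy hlt => ?_⟩
  by_contra hcon
  have hge : r ≤ ‖y - x‖ := (min_le_right r₀ (ε / 2)).trans (by linarith)
  have hn : 0 < ‖y - x‖ := hr0.trans_le hge
  set s := r / ‖y - x‖ with hs
  have hs0 : 0 < s := by positivity
  obtain ⟨hC, hle⟩ := add_smul_le_of_convexOn h.closedConvex.convexOn (interior_subset hx)
    (interior_subset hy) hs0.le ((div_le_one hn).2 hge)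
  have h1 := hδle (x + s • (y - x)) (by
    rw [mem_sphere_iff_norm, add_sub_cancel_left, norm_smul, Real.norm_eq_abs,
      abs_of_pos hs0, hs, div_mul_cancel₀ _ hn.ne'])
  rw [add_sub_cancel_left, real_inner_smul_right] at h1
  have h2 := h.gradient_le hy (interior_subset hx)
  have h3 : g y - g x - ⟪g' x, y - x⟫ ≤ ⟪g' y - g' x, y - x⟫ := by
    rw [inner_sub_left]
    have : ⟪g' y, x - y⟫ = -⟪g' y, y - x⟫ := by rw [← inner_neg_right, neg_sub]
    linarith
  have h4 := real_inner_le_norm (g' y - g' x) (y - x)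
  have h5 : δ ≤ s * (‖g' y - g' x‖ * ‖y - x‖) := by
    have := mul_le_mul_of_nonneg_left (h3.trans h4) hs0.le
    rw [mul_sub, mul_sub] at this
    linarith
  have h6 : s * (‖g' y - g' x‖ * ‖y - x‖) = ‖g' y - g' x‖ * r := by
    rw [hs]; field_simp
  rw [h6] at h5
  rw [lt_div_iff₀ hr0] at hlt
  linarith

theorem tendsto_of_tendsto_gradient {x : E} (hx : x ∈ interior D) {u : ℕ → E}
    (hu : ∀ n, u n ∈ interior D) (hlim : Tendsto (fun n => g' (u n)) atTop (𝓝 (g' x))) :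
    Tendsto u atTop (𝓝 x) := by
  rw [Metric.tendsto_atTop] at hlim ⊢
  intro ε hε
  obtain ⟨η, hη, hc⟩ := h.gradient_inverse_continuous hx hε
  obtain ⟨N, hN⟩ := hlim η hη
  refine ⟨N, fun n hn => ?_⟩
  have := hN n hn
  rw [dist_eq_norm] at this ⊢
  exact hc _ (hu n) this

/-- The maximizers that define the Legendre transform are the preimages under the gradient. -/
theorem mem_interior_of_conj_max {ρ x : E} (hne : (interior D).Nonempty) (hx : x ∈ D)
    (hmax : ∀ y ∈ D, ⟪y, ρ⟫ - g y ≤ ⟪x, ρ⟫ - g x) : x ∈ interior D ∧ g' x = ρ := by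
  obtain ⟨z, hz⟩ := hne
  have hf : ConvexOn ℝ D (fun _ => (0 : ℝ)) := convexOn_const _ h.closedConvex.convexOn.1
  have hmin : ∀ y ∈ D, g x - ⟪ρ, x⟫ + 0 ≤ g y - ⟪ρ, y⟫ + 0 := fun y hy => by
    have := hmax y hy
    rw [real_inner_comm, real_inner_comm ρ x] at this
    linarith
  have hxD := h.mem_interior_of_isMin Subset.rfl hf hx (interior_subset hz) hz hmin
  refine ⟨hxD, ?_⟩
  -- An interior point can move along ρ - g' x itself; optimality then gives t‖ρ - g' x‖² ≤ 0.
  have hev : ∀ᶠ t : ℝ in 𝓝[>] 0, x + t • (ρ - g' x) ∈ D := by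
    have hc : Continuous fun t : ℝ => x + t • (ρ - g' x) := by fun_prop
    have : ∀ᶠ t : ℝ in 𝓝 0, x + t • (ρ - g' x) ∈ interior D :=
      hc.continuousAt.eventually (by simpa using isOpen_interior.mem_nhds hxD)
    exact (this.filter_mono nhdsWithin_le_nhds).mono fun t ht => interior_subset ht
  obtain ⟨t, htD, ht⟩ := (hev.and self_mem_nhdsWithin).exists
  have h1 := h.subgradient_of_isMin hf hx hxD hmin htD
  rw [add_sub_cancel_left, real_inner_smul_right, zero_add] at h1
  have h2 := real_inner_self_nonpos.1 (nonpos_of_mul_nonpos_right h1 ht)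
  exact (sub_eq_zero.1 h2).symm

end IsLegendreReal

end Real

/-! ### Differentiability of the conjugate, existence of minimizers, limits of gradients. -/

section Real

variable {E : Type*} [NormedAddCommGroup E] [InnerProductSpace ℝ E]

/-- The gap at `y` between `f` and the affine function with slope `α` that agrees with `f` at `s`;
for `α` the gradient at `s` this is the Bregman divergence. -/
def linGap (f : E → ℝ) (s α y : E) : ℝ := f y - f s - inner ℝ α (y - s)

/-- With a' and b' the gradients of g at a and b, the slope α + a' - b' is the updated correction.
This exact bookkeeping of one half-step drives the energy decrease. -/
theorem linGap_step (g f : E → ℝ) (a b s z a' b' α : E) :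
    linGap g a a' z + linGap f s α z =
      linGap g b b' z + linGap f b (α + a' - b') z + linGap g a a' b + linGap f s α b := by
  simp only [linGap, inner_add_left, inner_sub_left, inner_sub_right]
  ring

namespace IsLegendreReal

variable [FiniteDimensional ℝ E] {D : Set E} {g : E → ℝ} {g' : E → E}
  (h : IsLegendreReal D g g')
include h

/-- If x and y are the maximizers at ρ and σ, then H σ - H ρ lies between ⟪x, σ - ρ⟫ and ⟪y, σ - ρ⟫,
and y tends to x by `gradient_inverse_continuous`. -/
theorem exists_hasGradientAt_conj {K : Set E} {H : E → ℝ} (hne : (interior D).Nonempty)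
    (hH : ∀ ρ ∈ K, ∃ x ∈ D, H ρ = ⟪x, ρ⟫ - g x ∧ ∀ y ∈ D, ⟪y, ρ⟫ - g y ≤ H ρ)
    {ρ : E} (hρ : ρ ∈ interior K) :
    ∃ x ∈ interior D, g' x = ρ ∧ HasGradientAt H x ρ := by
  have hH' : ∀ σ ∈ K, ∃ x ∈ interior D, g' x = σ ∧ H σ = ⟪x, σ⟫ - g x ∧
      ∀ y ∈ D, ⟪y, σ⟫ - g y ≤ H σ := by
    intro σ hσ
    obtain ⟨x, hx, hxe, hmax⟩ := hH σ hσ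
    obtain ⟨h1, h2⟩ := h.mem_interior_of_conj_max hne hx (fun y hy => hxe ▸ hmax y hy)
    exact ⟨x, h1, h2, hxe, hmax⟩
  obtain ⟨x, hx, hgx, hxe, hmax⟩ := hH' ρ (interior_subset hρ)
  refine ⟨x, hx, hgx, ?_⟩
  rw [hasGradientAt_iff_isLittleO, Asymptotics.isLittleO_iff]
  intro ε hε
  obtain ⟨η, hη, hc⟩ := h.gradient_inverse_continuous hx hε
  filter_upwards [mem_interior_iff_mem_nhds.1 hρ, Metric.ball_mem_nhds ρ hη] with σ hσ hση
  obtain ⟨y, hy, hgy, hye, hmaxy⟩ := hH' σ hσ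
  rw [mem_ball_iff_norm] at hση
  have h1 := hmaxy x (interior_subset hx)
  have h2 := hmax y (interior_subset hy)
  have h3 := (hc y hy (by rwa [hgx, hgy])).le
  have h4 : ⟪y - x, σ - ρ⟫ ≤ ε * ‖σ - ρ‖ :=
    (real_inner_le_norm _ _).trans (by gcongr)
  simp only [inner_sub_left, inner_sub_right] at h4 ⊢
  rw [Real.norm_eq_abs, abs_le]
  constructor <;> [skip; linarith]
  have : 0 ≤ ε * ‖σ - ρ‖ := by positivity
  linarith

/-- H is continuous, hence bounded on the ball of radius R; the maximal property is used at the
slope R y / ‖y‖. -/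
theorem exists_superlinear_bound {H : E → ℝ} (hne : (interior D).Nonempty)
    (hH : ∀ ρ, ∃ x ∈ D, H ρ = ⟪x, ρ⟫ - g x ∧ ∀ y ∈ D, ⟪y, ρ⟫ - g y ≤ H ρ) {R : ℝ} (hR : 0 ≤ R) :
    ∃ B : ℝ, ∀ y ∈ D, R * ‖y‖ - B ≤ g y := by
  have hcont : Continuous H := continuous_iff_continuousAt.2 fun ρ => by
    obtain ⟨x, -, -, hx⟩ := h.exists_hasGradientAt_conj hne (K := univ) (fun ρ _ => hH ρ)
      (ρ := ρ) (by simp)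
    exact hx.differentiableAt.continuousAt
  obtain ⟨B, hB⟩ := (isCompact_closedBall (0 : E) R).bddAbove_image hcont.continuousOn
  refine ⟨B, fun y hy => ?_⟩
  rcases eq_or_ne y 0 with rfl | h0
  · obtain ⟨-, -, -, hm⟩ := hH 0
    have h1 := hm 0 hy
    have h2 : H 0 ≤ B := hB ⟨0, by simpa using hR, rfl⟩
    simp only [inner_zero_left, norm_zero, mul_zero] at *
    linarith
  · have hn : 0 < ‖y‖ := norm_pos_iff.2 h0
    obtain ⟨-, -, -, hm⟩ := hH ((R / ‖y‖) • y)
    have h1 := hm y hy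
    have h2 : H ((R / ‖y‖) • y) ≤ B := hB ⟨_, by
      rw [mem_closedBall_zero_iff, norm_smul, Real.norm_eq_abs, abs_of_nonneg (by positivity),
        div_mul_cancel₀ _ hn.ne'], rfl⟩
    rw [real_inner_smul_right, real_inner_self_eq_norm_sq] at h1
    have : R / ‖y‖ * ‖y‖ ^ 2 = R * ‖y‖ := by field_simp
    linarith

theorem exists_isMin {H : E → ℝ}
    (hH : ∀ ρ, ∃ x ∈ D, H ρ = ⟪x, ρ⟫ - g x ∧ ∀ y ∈ D, ⟪y, ρ⟫ - g y ≤ H ρ)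
    {C : Set E} {f : E → ℝ} (hf : IsClosedConvexOn D C f) {z : E} (hz : z ∈ C)
    (hzD : z ∈ interior D) (ρ : E) :
    ∃ x ∈ C, ∀ y ∈ C, g x - ⟪ρ, x⟫ + f x ≤ g y - ⟪ρ, y⟫ + f y := by
  obtain ⟨a, b, hb, hfb⟩ := hf.exists_lower_bound hz hzD
  -- The terms ‖ρ‖ and b offset the linear term and the decay of f; the 1 leaves coercivity.
  obtain ⟨B, hB⟩ := h.exists_superlinear_bound ⟨z, hzD⟩ hH
    (R := 1 + ‖ρ‖ + b) (by positivity)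
  set F : E → ℝ := fun y => g y - ⟪ρ, y⟫ + f y with hF
  have hfb' : ∀ y ∈ C, a - b * ‖z‖ - b * ‖y‖ ≤ f y := fun y hy => by
    have h1 := hfb y hy
    have h2 := mul_le_mul_of_nonneg_left (norm_sub_le y z) hb
    linarith
  have hlow : ∀ y ∈ C, ‖y‖ - (B - a + b * ‖z‖) ≤ F y := fun y hy => by
    have h1 := hfb' y hy
    have h2 := hB y (hf.subset hy)
    have h3 := real_inner_le_norm ρ y
    simp only [hF]
    linarith
  have hbdd : BddBelow (F '' C) := ⟨-(B - a + b * ‖z‖), by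
    rintro _ ⟨y, hy, rfl⟩
    have := hlow y hy
    have := norm_nonneg y
    linarith⟩
  obtain ⟨w, hwanti, hwlim, hw⟩ := exists_seq_tendsto_sInf (Set.Nonempty.image F ⟨z, hz⟩) hbdd
  choose u huC hu using hw
  set m := sInf (F '' C) with hm
  set N : ℝ := w 0 + (B - a + b * ‖z‖) with hN
  have hnorm : ∀ n, ‖u n‖ ≤ N := fun n => by
    have h1 := hlow _ (huC n)
    have h2 := hwanti (Nat.zero_le n)
    rw [hu] at h1
    linarith
  have hN0 : 0 ≤ N := (norm_nonneg _).trans (hnorm 0)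
  -- With g bounded along the sequence, a subsequence makes the values of g, hence of f, converge
  -- separately. Closedness of g then puts the limit in D, as closedness of f requires.
  have hg : ∀ n, |g (u n)| ≤ |w 0| + ‖ρ‖ * N + |a| + b * ‖z‖ + b * N + |B| := fun n => by
    have h1 := hwanti (Nat.zero_le n)
    rw [← hu n] at h1
    simp only [hF] at h1
    have h2 := hfb' _ (huC n)
    have h3 := hB _ (hf.subset (huC n))
    have h4 := (real_inner_le_norm ρ (u n)).trans
      (mul_le_mul_of_nonneg_left (hnorm n) (norm_nonneg ρ))
    have h5 := mul_le_mul_of_nonneg_left (hnorm n) hb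
    have h6 : 0 ≤ (1 + ‖ρ‖ + b) * ‖u n‖ := by positivity
    have h7 := abs_nonneg (w 0)
    have h8 := abs_nonneg a
    have h9 := abs_nonneg B
    have h10 : 0 ≤ ‖ρ‖ * N := by positivity
    have h11 : 0 ≤ b * N := by positivity
    have h12 : 0 ≤ b * ‖z‖ := by positivity
    have h13 := le_abs_self (w 0)
    have h14 := neg_abs_le a
    have h15 := le_abs_self B
    rw [abs_le]
    constructor <;> linarith
  obtain ⟨⟨x, α⟩, -, ψ, hψ, hlim⟩ := tendsto_subseq_of_bounded
    (s := Metric.closedBall (0 : E) N ×ˢ Icc (-(|w 0| + ‖ρ‖ * N + |a| + b * ‖z‖ + b * N + |B|))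
      (|w 0| + ‖ρ‖ * N + |a| + b * ‖z‖ + b * N + |B|))
    (Metric.isBounded_closedBall.prod (Metric.isBounded_Icc _ _))
    (x := fun n => (u n, g (u n)))
    (fun n => ⟨by simpa using hnorm n, abs_le.1 (hg n)⟩)
  rw [Prod.tendsto_iff] at hlim
  obtain ⟨hx, hα⟩ := hlim
  obtain ⟨hxD, hgx⟩ := h.closedConvex.closed (fun n => u (ψ n)) (fun n => g (u (ψ n))) x α
    (fun n => hf.subset (huC _)) (mem_univ _) hx hα fun n => le_rfl
  have hflim : Tendsto (fun n => w (ψ n) - g (u (ψ n)) + ⟪ρ, u (ψ n)⟫) atTop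
      (𝓝 (m - α + ⟪ρ, x⟫)) :=
    ((hwlim.comp hψ.tendsto_atTop).sub hα).add (tendsto_const_nhds.inner hx)
  obtain ⟨hxC, hfx⟩ := hf.closed (fun n => u (ψ n)) _ x _ (fun n => huC _) hxD hx hflim
    fun n => by
      have := hu (ψ n)
      simp only [hF] at this
      linarith
  refine ⟨x, hxC, fun y hy => ?_⟩
  have h1 : m ≤ F y := csInf_le hbdd ⟨y, hy, rfl⟩
  simp only [hF] at h1
  linarith

/-- Bounded divergences to z bound the conjugate along the gradients, and the bound survives in the
limit ρ. Attainment then makes ρ a gradient at an interior point. -/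
theorem exists_tendsto_of_gradient_tendsto
    (hconj : ∀ ρ : E, (∃ B : ℝ, ∀ y ∈ D, ⟪y, ρ⟫ - g y ≤ B) →
      ∃ x ∈ D, ∀ y ∈ D, ⟪y, ρ⟫ - g y ≤ ⟪x, ρ⟫ - g x)
    {z : E} (hz : z ∈ interior D) {u : ℕ → E} (hu : ∀ n, u n ∈ interior D) {B : ℝ}
    (hB : ∀ n, linGap g (u n) (g' (u n)) z ≤ B) {ρ : E}
    (hρ : Tendsto (fun n => g' (u n)) atTop (𝓝 ρ)) :
    ∃ x ∈ interior D, g' x = ρ ∧ Tendsto u atTop (𝓝 x) := by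
  obtain ⟨x, hx, hmax⟩ := hconj ρ ⟨B - g z + ⟪ρ, z⟫, fun y hy => by
    refine le_of_tendsto_of_tendsto' ((tendsto_const_nhds.inner hρ).sub tendsto_const_nhds)
      (tendsto_const_nhds.add (hρ.inner tendsto_const_nhds)) fun n => ?_
    have h1 := h.gradient_le (hu n) hy
    have h2 := hB n
    rw [linGap] at h2
    rw [inner_sub_right] at h1 h2
    rw [real_inner_comm]
    linarith⟩
  obtain ⟨hxD, rfl⟩ := h.mem_interior_of_conj_max ⟨z, hz⟩ hx hmax
  exact ⟨x, hxD, rfl, h.tendsto_of_tendsto_gradient hxD hu hρ⟩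

end IsLegendreReal

end Real

/-! ### Energy decrease and convergence of the iterates. -/

section Real

variable {E : Type*} [NormedAddCommGroup E] [InnerProductSpace ℝ E]

/-- Bregman–Dykstra iterates in terms of subgradients, where `p` and `q` are the iterates with odd
and with even index, and `α` and `β` the corresponding correction terms. -/
structure IsDykstraPair (D : Set E) (g' : E → E) (C₁ C₂ : Set E) (f₁ f₂ : E → ℝ) (ρ : E)
    (p q α β : ℕ → E) : Prop where
  p_mem : ∀ k, p k ∈ interior D
  q_mem : ∀ k, q k ∈ interior D
  p_dom : ∀ k, p k ∈ C₁
  q_dom : ∀ k, q k ∈ C₂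
  α_subgradient : ∀ k, ∀ y ∈ C₁, 0 ≤ linGap f₁ (p k) (α k) y
  β_subgradient : ∀ k, ∀ y ∈ C₂, 0 ≤ linGap f₂ (q k) (β k) y
  α_succ : ∀ k, α (k + 1) = α k + g' (q k) - g' (p (k + 1))
  β_succ : ∀ k, β (k + 1) = β k + g' (p (k + 1)) - g' (q (k + 1))
  add_eq : ∀ k, g' (q k) + (α k + β k) = ρ

theorem IsClosedConvexOn.linGap_limit {D C : Set E} {f : E → ℝ} (hf : IsClosedConvexOn D C f)
    {s α u : ℕ → E} {x w : E} (hs : ∀ n, s n ∈ C) (hx : x ∈ D)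
    (hα : ∀ n, ∀ y ∈ C, 0 ≤ linGap f (s n) (α n) y)
    (hu : ∀ n, ∀ y ∈ C, ∀ y' ∈ C, ⟪u n, y - y'⟫ = ⟪α n, y - y'⟫)
    (hsx : Tendsto s atTop (𝓝 x)) (huw : Tendsto u atTop (𝓝 w)) :
    x ∈ C ∧ ∀ y ∈ C, 0 ≤ linGap f x w y := by
  have key : ∀ y ∈ C, x ∈ C ∧ f x ≤ f y - ⟪w, y - x⟫ := fun y hy =>
    hf.closed s (fun n => f y - ⟪u n, y - s n⟫) x _ hs hx hsx
      (tendsto_const_nhds.sub (huw.inner (tendsto_const_nhds.sub hsx))) fun n => by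
        have := hα n y hy
        rw [linGap, ← hu n y hy _ (hs n)] at this
        linarith
  refine ⟨(key _ (hs 0)).1, fun y hy => ?_⟩
  have := (key y hy).2
  rw [linGap]
  linarith

namespace IsLegendreReal

variable [FiniteDimensional ℝ E] {D : Set E} {g : E → ℝ} {g' : E → E}
  (h : IsLegendreReal D g g')
include h

theorem linGap_nonneg {x y : E} (hx : x ∈ interior D) (hy : y ∈ D) :
    0 ≤ linGap g x (g' x) y := by
  have := h.gradient_le hx hy
  rw [linGap]
  linarith

theorem dykstra_energy {C₁ C₂ : Set E} {f₁ f₂ : E → ℝ} {ρ : E} {p q α β : ℕ → E}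
    (hd : IsDykstraPair D g' C₁ C₂ f₁ f₂ ρ p q α β) {z : E} (hzD : z ∈ interior D)
    (hz₁ : z ∈ C₁) (hz₂ : z ∈ C₂) :
    (∃ B : ℝ, ∀ k, linGap g (p (k + 1)) (g' (p (k + 1))) z ≤ B ∧
      linGap g (q (k + 1)) (g' (q (k + 1))) z ≤ B ∧
      linGap f₁ (p (k + 1)) (α (k + 1)) z ≤ B ∧ linGap f₂ (q (k + 1)) (β (k + 1)) z ≤ B) ∧
    Tendsto (fun k => linGap g (p (k + 1)) (g' (p (k + 1))) (q (k + 1))) atTop (𝓝 0) := by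
  -- By `linGap_step` on both half-steps, W k - W (k + 1) is a sum of four nonnegative gaps, one of
  -- them the divergence from p (k + 1) to q (k + 1).
  set W : ℕ → ℝ := fun k => linGap g (q k) (g' (q k)) z + linGap f₁ (p k) (α k) z +
    linGap f₂ (q k) (β k) z with hW
  have hz := interior_subset hzD
  have hW0 : ∀ k, 0 ≤ W k := fun k =>
    add_nonneg (add_nonneg (h.linGap_nonneg (hd.q_mem k) hz) (hd.α_subgradient k z hz₁))
      (hd.β_subgradient k z hz₂)
  have step : ∀ k, linGap g (p (k + 1)) (g' (p (k + 1))) z ≤ W k ∧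
      linGap g (p (k + 1)) (g' (p (k + 1))) (q (k + 1)) ≤ W k - W (k + 1) := fun k => by
    have e1 := linGap_step g f₁ (q k) (p (k + 1)) (p k) z (g' (q k)) (g' (p (k + 1))) (α k)
    have e2 := linGap_step g f₂ (p (k + 1)) (q (k + 1)) (q k) z (g' (p (k + 1)))
      (g' (q (k + 1))) (β k)
    rw [← hd.α_succ] at e1
    rw [← hd.β_succ] at e2
    have n1 := h.linGap_nonneg (hd.q_mem k) (interior_subset (hd.p_mem (k + 1)))
    have n2 := hd.α_subgradient k _ (hd.p_dom (k + 1))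
    have n3 := hd.β_subgradient k _ (hd.q_dom (k + 1))
    have n4 := hd.α_subgradient (k + 1) z hz₁
    have n5 := hd.β_subgradient k z hz₂
    simp only [hW]
    constructor <;> linarith
  have nonneg : ∀ k, 0 ≤ linGap g (p (k + 1)) (g' (p (k + 1))) (q (k + 1)) := fun k =>
    h.linGap_nonneg (hd.p_mem _) (interior_subset (hd.q_mem _))
  have hanti : Antitone W := antitone_nat_of_succ_le fun k => by
    linarith [(step k).2, nonneg k]
  constructor
  · refine ⟨W 0, fun k => ?_⟩
    have h1 := h.linGap_nonneg (hd.q_mem (k + 1)) hz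
    have h2 := hd.α_subgradient (k + 1) z hz₁
    have h3 := hd.β_subgradient (k + 1) z hz₂
    have h4 : W (k + 1) ≤ W 0 := hanti (Nat.zero_le _)
    refine ⟨(step k).1.trans (hanti (Nat.zero_le _)), ?_, ?_, ?_⟩ <;>
    · simp only [hW] at h4 ⊢
      linarith
  · have hlim := tendsto_atTop_ciInf hanti ⟨0, by rintro _ ⟨k, rfl⟩; exact hW0 k⟩
    have hdiff := hlim.sub (hlim.comp (tendsto_add_atTop_nat 1))
    rw [sub_self] at hdiff
    exact squeeze_zero nonneg (fun k => (step k).2) hdiff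

theorem exists_bound_norm_gradient {z : E} (hz : z ∈ interior D) (B : ℝ) :
    ∃ R : ℝ, ∀ x ∈ interior D, linGap g x (g' x) z ≤ B → ‖g' x‖ ≤ R := by
  obtain ⟨r, hr, M, hM⟩ := h.exists_norm_gradient_le hz
  refine ⟨(M - g z + B) / r, fun x hx hB => ?_⟩
  rw [le_div_iff₀ hr, mul_comm]
  have := hM x hx
  rw [linGap] at hB
  linarith

theorem dykstra_subseq
    (hconj : ∀ ρ : E, (∃ B : ℝ, ∀ y ∈ D, ⟪y, ρ⟫ - g y ≤ B) →
      ∃ x ∈ D, ∀ y ∈ D, ⟪y, ρ⟫ - g y ≤ ⟪x, ρ⟫ - g x)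
    {C₁ C₂ : Set E} {f₁ f₂ : E → ℝ} (hf₁ : IsClosedConvexOn D C₁ f₁)
    (hf₂ : IsClosedConvexOn D C₂ f₂) {ρ : E} {p q α β : ℕ → E}
    (hd : IsDykstraPair D g' C₁ C₂ f₁ f₂ ρ p q α β) {z : E} (hzD : z ∈ interior D)
    (hz₁ : z ∈ intrinsicInterior ℝ C₁) (hz₂ : z ∈ intrinsicInterior ℝ C₂) {ns : ℕ → ℕ}
    (hns : Tendsto ns atTop atTop) :
    ∃ ms : ℕ → ℕ, ∃ x ∈ interior D, (x ∈ C₁ ∧ x ∈ C₂) ∧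
      (∀ y, y ∈ C₁ → y ∈ C₂ → g x - ⟪ρ, x⟫ + (f₁ x + f₂ x) ≤ g y - ⟪ρ, y⟫ + (f₁ y + f₂ y)) ∧
      Tendsto (fun k => p (ns (ms k) + 1)) atTop (𝓝 x) ∧
      Tendsto (fun k => q (ns (ms k) + 1)) atTop (𝓝 x) := by
  obtain ⟨⟨B, hB⟩, hgap⟩ := h.dykstra_energy hd hzD (intrinsicInterior_subset hz₁)
    (intrinsicInterior_subset hz₂)
  obtain ⟨R, hR⟩ := h.exists_bound_norm_gradient hzD B
  obtain ⟨r₁, hr₁, M₁, hM₁⟩ := exists_projected_subgradient hf₁.convexOn hz₁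
  obtain ⟨r₂, hr₂, M₂, hM₂⟩ := exists_projected_subgradient hf₂.convexOn hz₂
  choose u hu hur using fun k => hM₁ (α (k + 1)) (p (k + 1)) (hd.p_dom _) fun y hy => by
    have := hd.α_subgradient (k + 1) y hy
    rw [linGap] at this
    linarith
  choose w hw hwr using fun k => hM₂ (β (k + 1)) (q (k + 1)) (hd.q_dom _) fun y hy => by
    have := hd.β_subgradient (k + 1) y hy
    rw [linGap] at this
    linarith
  have hub : ∀ k, ‖u k‖ ≤ (M₁ - f₁ z + B) / r₁ := fun k => by
    rw [le_div_iff₀ hr₁, mul_comm]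
    have h1 := hur k
    have h2 := (hB k).2.2.1
    rw [linGap] at h2
    linarith
  have hwb : ∀ k, ‖w k‖ ≤ (M₂ - f₂ z + B) / r₂ := fun k => by
    rw [le_div_iff₀ hr₂, mul_comm]
    have h1 := hwr k
    have h2 := (hB k).2.2.2
    rw [linGap] at h2
    linarith
  obtain ⟨⟨⟨a, b⟩, c, d⟩, -, ms, hms, hlim⟩ := tendsto_subseq_of_bounded
    (s := (Metric.closedBall (0 : E) R ×ˢ Metric.closedBall (0 : E) R) ×ˢ
      Metric.closedBall (0 : E) ((M₁ - f₁ z + B) / r₁) ×ˢ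
      Metric.closedBall (0 : E) ((M₂ - f₂ z + B) / r₂))
    ((Metric.isBounded_closedBall.prod Metric.isBounded_closedBall).prod
      (Metric.isBounded_closedBall.prod Metric.isBounded_closedBall))
    (x := fun k => ((g' (p (ns k + 1)), g' (q (ns k + 1))), u (ns k), w (ns k)))
    (fun k => ⟨⟨mem_closedBall_zero_iff.2 (hR _ (hd.p_mem _) (hB _).1),
      mem_closedBall_zero_iff.2 (hR _ (hd.q_mem _) (hB _).2.1)⟩,
      mem_closedBall_zero_iff.2 (hub _), mem_closedBall_zero_iff.2 (hwb _)⟩)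
  obtain ⟨hlim1, hlim2⟩ := Prod.tendsto_iff _ _ |>.1 hlim
  obtain ⟨hga, hgb⟩ := Prod.tendsto_iff _ _ |>.1 hlim1
  obtain ⟨huc, hwd⟩ := Prod.tendsto_iff _ _ |>.1 hlim2
  simp only [Function.comp_def] at hga hgb huc hwd
  obtain ⟨x, hx, hgx, hpx⟩ := h.exists_tendsto_of_gradient_tendsto hconj hzD
    (fun k => hd.p_mem (ns (ms k) + 1)) (fun k => (hB _).1) hga
  obtain ⟨y, hy, hgy, hqy⟩ := h.exists_tendsto_of_gradient_tendsto hconj hzD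
    (fun k => hd.q_mem (ns (ms k) + 1)) (fun k => (hB _).2.1) hgb
  -- The divergence between consecutive iterates tends to 0, yet its limit would be positive for
  -- distinct interior points.
  have hxy : x = y := by
    by_contra hne
    have h1 := h.gradient_lt hx hy hne
    have h2 : Tendsto (fun k => linGap g (p (ns (ms k) + 1)) (g' (p (ns (ms k) + 1)))
        (q (ns (ms k) + 1))) atTop (𝓝 (g y - g x - ⟪a, y - x⟫)) :=
      (((h.hasGradientAt y hy).differentiableAt.continuousAt.tendsto.comp hqy).sub
        ((h.hasGradientAt x hx).differentiableAt.continuousAt.tendsto.comp hpx)).sub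
        (hga.inner (hqy.sub hpx))
    have h3 := tendsto_nhds_unique h2 (hgap.comp (hns.comp hms.tendsto_atTop))
    rw [hgx] at h1
    linarith
  subst hxy
  have hxD := interior_subset hx
  obtain ⟨hx₁, hc⟩ := hf₁.linGap_limit (fun k => hd.p_dom (ns (ms k) + 1)) hxD
    (fun k => hd.α_subgradient (ns (ms k) + 1)) (fun k => hu (ns (ms k))) hpx huc
  obtain ⟨hx₂, hd'⟩ := hf₂.linGap_limit (fun k => hd.q_dom (ns (ms k) + 1)) hxD
    (fun k => hd.β_subgradient (ns (ms k) + 1)) (fun k => hw (ns (ms k))) hqy hwd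
  refine ⟨ms, x, hx, ⟨hx₁, hx₂⟩, fun y hy₁ hy₂ => ?_, hpx, hqy⟩
  have h1 := hc y hy₁
  have h2 := hd' y hy₂
  have h3 := h.gradient_le hx (hf₁.subset hy₁)
  -- The corrections were projected onto two different subspaces, so the conserved sum survives only
  -- when tested on differences of points of C₁ ∩ C₂.
  have h4 : ⟪g' x, y - x⟫ + (⟪c, y - x⟫ + ⟪d, y - x⟫) = ⟪ρ, y - x⟫ := by
    rw [hgy]
    refine tendsto_nhds_unique ((hgb.inner tendsto_const_nhds).add
      ((huc.inner tendsto_const_nhds).add (hwd.inner tendsto_const_nhds)))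
      (tendsto_const_nhds.congr fun k => ?_)
    rw [hu _ y hy₁ x hx₁, hw _ y hy₂ x hx₂, ← hd.add_eq (ns (ms k) + 1), inner_add_left,
      inner_add_left]
  rw [linGap] at h1 h2
  rw [inner_sub_right ρ] at h4
  linarith

theorem dykstra_tendsto
    (hconj : ∀ ρ : E, (∃ B : ℝ, ∀ y ∈ D, ⟪y, ρ⟫ - g y ≤ B) →
      ∃ x ∈ D, ∀ y ∈ D, ⟪y, ρ⟫ - g y ≤ ⟪x, ρ⟫ - g x)
    {C₁ C₂ : Set E} {f₁ f₂ : E → ℝ} (hf₁ : IsClosedConvexOn D C₁ f₁)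
    (hf₂ : IsClosedConvexOn D C₂ f₂) {ρ : E} {p q α β : ℕ → E}
    (hd : IsDykstraPair D g' C₁ C₂ f₁ f₂ ρ p q α β) {z : E} (hzD : z ∈ interior D)
    (hz₁ : z ∈ intrinsicInterior ℝ C₁) (hz₂ : z ∈ intrinsicInterior ℝ C₂) :
    ∃ x ∈ C₁ ∩ C₂,
      (∀ y ∈ C₁ ∩ C₂, g x - ⟪ρ, x⟫ + (f₁ x + f₂ x) ≤ g y - ⟪ρ, y⟫ + (f₁ y + f₂ y)) ∧
      (∀ x' ∈ C₁ ∩ C₂, (∀ y ∈ C₁ ∩ C₂,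
        g x' - ⟪ρ, x'⟫ + (f₁ x' + f₂ x') ≤ g y - ⟪ρ, y⟫ + (f₁ y + f₂ y)) → x' = x) ∧
      Tendsto p atTop (𝓝 x) ∧ Tendsto q atTop (𝓝 x) := by
  have hsub : C₁ ∩ C₂ ⊆ D := inter_subset_left.trans hf₁.subset
  have hcv : Convex ℝ (C₁ ∩ C₂) := hf₁.convexOn.1.inter hf₂.convexOn.1
  have hf : ConvexOn ℝ (C₁ ∩ C₂) (fun y => f₁ y + f₂ y) :=
    (hf₁.convexOn.subset inter_subset_left hcv).add (hf₂.convexOn.subset inter_subset_right hcv)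
  have hz : z ∈ C₁ ∩ C₂ := ⟨intrinsicInterior_subset hz₁, intrinsicInterior_subset hz₂⟩
  obtain ⟨-, x, hx, hxC, hmin, -, -⟩ :=
    h.dykstra_subseq hconj hf₁ hf₂ hd hzD hz₁ hz₂ tendsto_id
  have uniq : ∀ x' ∈ C₁ ∩ C₂, (∀ y ∈ C₁ ∩ C₂,
      g x' - ⟪ρ, x'⟫ + (f₁ x' + f₂ x') ≤ g y - ⟪ρ, y⟫ + (f₁ y + f₂ y)) → x' = x :=
    fun x' hx' hmin' => h.eq_of_isMin hf hx'
      (h.mem_interior_of_isMin hsub hf hx' hz hzD hmin') hxC hx hmin'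
      fun y hy => hmin y hy.1 hy.2
  refine ⟨x, hxC, fun y hy => hmin y hy.1 hy.2, uniq, ?_, ?_⟩
  all_goals
    rw [← tendsto_add_atTop_iff_nat 1]
    refine tendsto_of_subseq_tendsto fun ns hns => ?_
    obtain ⟨ms, x', -, hx', hmin', hp, hq⟩ :=
      h.dykstra_subseq hconj hf₁ hf₂ hd hzD hz₁ hz₂ hns
    obtain rfl := uniq x' hx' fun y hy => hmin' y hy.1 hy.2
    first
      | exact ⟨ms, hp⟩
      | exact ⟨ms, hq⟩

end IsLegendreReal

theorem tendsto_of_odd_of_even {X : Type*} [TopologicalSpace X] {u : ℕ → X} {x : X}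
    (hodd : Tendsto (fun k => u (2 * k + 1)) atTop (𝓝 x))
    (heven : Tendsto (fun k => u (2 * k + 2)) atTop (𝓝 x)) : Tendsto u atTop (𝓝 x) := by
  intro s hs
  obtain ⟨N, hN⟩ := eventually_atTop.1 ((hodd.eventually hs).and (heven.eventually hs))
  refine eventually_atTop.2 ⟨2 * N + 1, fun n hn => ?_⟩
  rcases Nat.even_or_odd' n with ⟨k, rfl | rfl⟩
  · obtain ⟨j, rfl⟩ : ∃ j, k = j + 1 := ⟨k - 1, by omega⟩
    exact (hN j (by omega)).2
  · exact (hN k (by omega)).1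

end Real

/-! ### From extended-valued to real-valued minimization. -/

section Basic

variable {E : Type*} {φ₁ φ₂ : E → EReal}

theorem isMin_iff_toReal {D : Set E} {ψ : E → EReal} (hbot : ∀ x ∈ D, ψ x ≠ ⊥)
    (hne : (domOn D ψ).Nonempty) (b : E → ℝ) (x : E) :
    (x ∈ D ∧ ∀ y ∈ D, (b x : EReal) + ψ x ≤ (b y : EReal) + ψ y) ↔
      x ∈ domOn D ψ ∧ ∀ y ∈ domOn D ψ, b x + (ψ x).toReal ≤ b y + (ψ y).toReal := by
  have coe : ∀ y ∈ domOn D ψ, (b y : EReal) + ψ y = ((b y + (ψ y).toReal : ℝ) : EReal) :=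
    fun y hy => by rw [EReal.coe_add, EReal.coe_toReal hy.2 (hbot y hy.1)]
  constructor
  · rintro ⟨hx, hmin⟩
    obtain ⟨z, hz⟩ := hne
    have hxC : x ∈ domOn D ψ := ⟨hx, fun htop => by
      have := hmin z hz.1
      rw [htop, EReal.coe_add_top, top_le_iff, coe z hz] at this
      exact EReal.coe_ne_top _ this⟩
    refine ⟨hxC, fun y hy => ?_⟩
    have := hmin y hy.1
    rwa [coe x hxC, coe y hy, EReal.coe_le_coe_iff] at this
  · rintro ⟨hx, hmin⟩
    refine ⟨hx.1, fun y hy => ?_⟩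
    by_cases htop : ψ y = ⊤
    · rw [htop, EReal.coe_add_top]
      exact le_top
    · rw [coe x hx, coe y ⟨hy, htop⟩, EReal.coe_le_coe_iff]
      exact hmin y ⟨hy, htop⟩

theorem domOn_univ (Γ : E → EReal) : domOn univ Γ = dom Γ := by
  ext x
  simp [domOn, dom]

theorem alternate_induction {P : (E → EReal) → Prop} (h₁ : P φ₁) (h₂ : P φ₂) (n : ℕ) :
    P (alternate φ₁ φ₂ n) := by
  unfold alternate
  split_ifs <;> assumption

theorem alternate_odd (k : ℕ) : alternate φ₁ φ₂ (2 * k + 1) = φ₁ :=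
  if_pos ⟨k, rfl⟩

theorem alternate_even (k : ℕ) : alternate φ₁ φ₂ (2 * k + 2) = φ₂ :=
  if_neg (by rw [Nat.not_odd_iff_even]; exact ⟨k + 1, by ring⟩)

end Basic

/-! ### The extended-valued iteration. -/

section Extended

variable {E : Type*} [NormedAddCommGroup E] [InnerProductSpace ℝ E]

theorem interior_of_mem_intrinsicInterior {D : Set E} (hD : (interior D).Nonempty) {z : E}
    (hz : z ∈ intrinsicInterior ℝ D) : z ∈ interior D := by
  have htop : affineSpan ℝ D = ⊤ := top_unique <|
    (isOpen_interior.affineSpan_eq_top hD).ge.trans (affineSpan_mono ℝ interior_subset)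
  obtain ⟨y, hy, rfl⟩ := mem_intrinsicInterior.1 hz
  let ι : E → affineSpan ℝ D := fun e => ⟨e, htop ▸ AffineSubspace.mem_top ℝ E e⟩
  have hι : Continuous ι := continuous_id.subtype_mk _
  exact interior_maximal (fun e he => interior_subset (s := ((↑) ⁻¹' D : Set (affineSpan ℝ D))) he)
    (isOpen_interior.preimage hι) (show ι y ∈ interior ((↑) ⁻¹' D : Set (affineSpan ℝ D)) from hy)

variable [CompleteSpace E] {Γ φ₁ φ₂ : E → EReal} {ξ : E}

theorem exists_isDykstra
    (hprox : ∀ φ, φ = φ₁ ∨ φ = φ₂ → ∀ ρ, ∃ x, IsBregmanProx Γ φ (grad (conj Γ) ρ) x)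
    (hfin : ∀ ρ : E, ρ ∈ dom (conj Γ)) (ξ : E) : ∃ x v : ℕ → E, IsDykstra Γ φ₁ φ₂ ξ x v := by
  choose T hT using fun n => hprox _ (alternate_induction (P := fun φ => φ = φ₁ ∨ φ = φ₂)
    (φ₁ := φ₁) (φ₂ := φ₂) (Or.inl rfl) (Or.inr rfl) (n + 1))
  -- The state is (π^(n), v^(n), v^(n-1)), which makes the two-step recursion one-step.
  let s : ℕ → E × E × E := fun n => Nat.rec (ξ, 0, 0) (fun n s =>
    (T n (grad Γ s.1 + s.2.2),
      s.2.2 + grad Γ s.1 - grad Γ (T n (grad Γ s.1 + s.2.2)), s.2.1)) n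
  have hlag : ∀ n, lag (fun n => (s n).2.1) n = (s n).2.2 := fun n => by cases n <;> rfl
  refine ⟨fun n => (s n).1, fun n => (s n).2.1, rfl, rfl, fun n => ?_, fun n => ?_, fun n => ?_⟩
  · rw [eq_univ_of_forall hfin, interior_univ]
    trivial
  · rw [hlag]
    exact hT n _
  · rw [hlag]

theorem IsDykstra.unique
    (hprox : ∀ φ, φ = φ₁ ∨ φ = φ₂ → ∀ ρ ∈ interior (dom (conj Γ)), ∀ x x',
      IsBregmanProx Γ φ (grad (conj Γ) ρ) x → IsBregmanProx Γ φ (grad (conj Γ) ρ) x' → x = x')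
    {x v x' v' : ℕ → E} (h : IsDykstra Γ φ₁ φ₂ ξ x v) (h' : IsDykstra Γ φ₁ φ₂ ξ x' v') :
    x = x' ∧ v = v' := by
  have key : ∀ n, x n = x' n ∧ v n = v' n ∧ lag v n = lag v' n := by
    intro n
    induction n with
    | zero => exact ⟨h.x_zero.trans h'.x_zero.symm, h.v_zero.trans h'.v_zero.symm, rfl⟩
    | succ n ih =>
      obtain ⟨h1, h2, h3⟩ := ih
      have hx : x (n + 1) = x' (n + 1) := by
        refine hprox _ (alternate_induction (P := fun φ => φ = φ₁ ∨ φ = φ₂)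
          (Or.inl rfl) (Or.inr rfl) (n + 1)) _ (h.mem n) _ _ (h.x_succ n) ?_
        rw [h1, h3]
        exact h'.x_succ n
      exact ⟨hx, by rw [h.v_succ, h'.v_succ, h1, h3, hx], h2⟩
  exact ⟨funext fun n => (key n).1, funext fun n => (key n).2.1⟩

theorem IsDykstra.grad_add {x v : ℕ → E} (h : IsDykstra Γ φ₁ φ₂ ξ x v) (n : ℕ) :
    grad Γ (x (n + 1)) + (v n + v (n + 1)) = grad Γ ξ := by
  induction n with
  | zero => rw [h.v_succ, h.v_zero, h.x_zero]; simp [lag]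
  | succ n ih => rw [h.v_succ (n + 1), ← ih]; simp only [lag]; abel

theorem IsLegendre.isLegendreReal (hΓ : IsLegendre Γ) :
    IsLegendreReal (dom Γ) (fun x => (Γ x).toReal) (grad Γ) where
  closedConvex := domOn_univ Γ ▸ hΓ.properConvexLsc.toReal_closedConvexOn
  hasGradientAt x hx := (hΓ.differentiable x hx).hasGradientAt
  strictConvexOn := hΓ.strictConvex
  blowup := hΓ.blowup

theorem IsLegendre.coe_toReal (hΓ : IsLegendre Γ) {x : E} (hx : x ∈ dom Γ) :
    (((Γ x).toReal : ℝ) : EReal) = Γ x :=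
  EReal.coe_toReal hx (hΓ.properConvexLsc.ne_bot x (mem_univ x))

theorem IsLegendre.bregman_eq (hΓ : IsLegendre Γ) {x p : E} (hx : x ∈ dom Γ) (hp : p ∈ dom Γ) :
    bregman Γ x p = ((linGap (fun y => (Γ y).toReal) p (grad Γ p) x : ℝ) : EReal) := by
  rw [bregman, linGap, EReal.coe_sub, EReal.coe_sub, hΓ.coe_toReal hx, hΓ.coe_toReal hp]

theorem IsLegendre.isMin_bregman_iff (hΓ : IsLegendre Γ) {p : E} (hp : p ∈ dom Γ)
    {ψ : E → EReal} (hbot : ∀ x ∈ dom Γ, ψ x ≠ ⊥) (hne : (domOn (dom Γ) ψ).Nonempty) (x : E) :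
    (x ∈ dom Γ ∧ ∀ y ∈ dom Γ, bregman Γ x p + ψ x ≤ bregman Γ y p + ψ y) ↔
      x ∈ domOn (dom Γ) ψ ∧ ∀ y ∈ domOn (dom Γ) ψ,
        (Γ x).toReal - ⟪grad Γ p, x⟫ + (ψ x).toReal ≤
          (Γ y).toReal - ⟪grad Γ p, y⟫ + (ψ y).toReal := by
  have h1 := isMin_iff_toReal hbot hne (linGap (fun y => (Γ y).toReal) p (grad Γ p)) x
  have h2 : ∀ y : E, linGap (fun y => (Γ y).toReal) p (grad Γ p) y =
      (Γ y).toReal - ⟪grad Γ p, y⟫ - ((Γ p).toReal - ⟪grad Γ p, p⟫) := fun y => by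
    rw [linGap, inner_sub_right]
    ring
  refine Iff.trans (and_congr_right fun hx => forall₂_congr fun y hy => ?_)
    (h1.trans (and_congr_right fun _ => forall₂_congr fun y _ => ?_))
  · rw [hΓ.bregman_eq hx hp, hΓ.bregman_eq hy hp]
  · rw [h2, h2]
    constructor <;> intro <;> linarith

theorem IsLegendre.isBregmanProx_iff (hΓ : IsLegendre Γ) {φ : E → EReal}
    (hφ : IsProperConvexLscOn (dom Γ) φ) {p : E} (hp : p ∈ dom Γ) (x : E) :
    IsBregmanProx Γ φ p x ↔ x ∈ domOn (dom Γ) φ ∧ ∀ y ∈ domOn (dom Γ) φ,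
      (Γ x).toReal - ⟪grad Γ p, x⟫ + (φ x).toReal ≤
        (Γ y).toReal - ⟪grad Γ p, y⟫ + (φ y).toReal :=
  hΓ.isMin_bregman_iff hp hφ.ne_bot hφ.nonempty x

theorem IsLegendre.isSolution_iff (hΓ : IsLegendre Γ) {φ₁ φ₂ : E → EReal}
    (hφ₁ : IsProperConvexLscOn (dom Γ) φ₁) (hφ₂ : IsProperConvexLscOn (dom Γ) φ₂)
    (hne : (domOn (dom Γ) φ₁ ∩ domOn (dom Γ) φ₂).Nonempty) {ξ : E} (hξ : ξ ∈ dom Γ) (x : E) :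
    IsSolution Γ φ₁ φ₂ ξ x ↔ x ∈ domOn (dom Γ) φ₁ ∩ domOn (dom Γ) φ₂ ∧
      ∀ y ∈ domOn (dom Γ) φ₁ ∩ domOn (dom Γ) φ₂,
      (Γ x).toReal - ⟪grad Γ ξ, x⟫ + ((φ₁ x).toReal + (φ₂ x).toReal) ≤
        (Γ y).toReal - ⟪grad Γ ξ, y⟫ + ((φ₁ y).toReal + (φ₂ y).toReal) := by
  have hdom : domOn (dom Γ) (fun y => φ₁ y + φ₂ y) =
      domOn (dom Γ) φ₁ ∩ domOn (dom Γ) φ₂ := by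
    ext y
    constructor
    · rintro ⟨hy, htop⟩
      refine ⟨⟨hy, fun h => htop ?_⟩, ⟨hy, fun h => htop ?_⟩⟩
      · simp only [h, EReal.top_add_of_ne_bot (hφ₂.ne_bot y hy)]
      · simp only [h, EReal.add_top_of_ne_bot (hφ₁.ne_bot y hy)]
    · rintro ⟨⟨hy, h1⟩, -, h2⟩
      exact ⟨hy, EReal.add_ne_top h1 h2⟩
  have h := hΓ.isMin_bregman_iff hξ (ψ := fun y => φ₁ y + φ₂ y)
    (fun y hy => by simp [EReal.add_eq_bot_iff, hφ₁.ne_bot y hy, hφ₂.ne_bot y hy])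
    (hdom ▸ hne) x
  have hadd : ∀ y ∈ domOn (dom Γ) φ₁ ∩ domOn (dom Γ) φ₂,
      (φ₁ y + φ₂ y).toReal = (φ₁ y).toReal + (φ₂ y).toReal := fun y hy =>
    EReal.toReal_add hy.1.2 (hφ₁.ne_bot y hy.1.1) hy.2.2 (hφ₂.ne_bot y hy.1.1)
  simp only [IsSolution, add_assoc]
  rw [h, hdom]
  refine and_congr_right fun hx => forall₂_congr fun y hy => ?_
  rw [hadd x hx, hadd y hy]

theorem IsLegendre.exists_conj_eq (hΓ : IsLegendre Γ) (hmax : ConjIsMax Γ) {ρ : E}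
    (hρ : ρ ∈ dom (conj Γ)) :
    ∃ x ∈ dom Γ, (conj Γ ρ).toReal = ⟪x, ρ⟫ - (Γ x).toReal ∧
      ∀ y ∈ dom Γ, ⟪y, ρ⟫ - (Γ y).toReal ≤ (conj Γ ρ).toReal := by
  obtain ⟨x, hx, hxe⟩ := hmax ρ hρ
  rw [← hΓ.coe_toReal hx, ← EReal.coe_sub] at hxe
  refine ⟨x, hx, by rw [hxe, EReal.toReal_coe], fun y hy => ?_⟩
  have h1 : ((⟪y, ρ⟫ : ℝ) : EReal) - Γ y ≤ conj Γ ρ :=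
    le_iSup (fun y => ((⟪y, ρ⟫ : ℝ) : EReal) - Γ y) y
  rw [← hΓ.coe_toReal hy, ← EReal.coe_sub, hxe, EReal.coe_le_coe_iff] at h1
  rwa [hxe, EReal.toReal_coe]

theorem IsLegendre.exists_max_of_bounded (hΓ : IsLegendre Γ) (hmax : ConjIsMax Γ) (ρ : E)
    (hB : ∃ B : ℝ, ∀ y ∈ dom Γ, ⟪y, ρ⟫ - (Γ y).toReal ≤ B) :
    ∃ x ∈ dom Γ, ∀ y ∈ dom Γ, ⟪y, ρ⟫ - (Γ y).toReal ≤ ⟪x, ρ⟫ - (Γ x).toReal := by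
  obtain ⟨B, hB⟩ := hB
  have hle : conj Γ ρ ≤ (B : EReal) := iSup_le fun y => by
    by_cases hy : Γ y = ⊤
    · rw [hy, EReal.sub_top]
      exact bot_le
    · rw [← hΓ.coe_toReal hy, ← EReal.coe_sub, EReal.coe_le_coe_iff]
      exact hB y hy
  obtain ⟨x, hx, hxe, hm⟩ := hΓ.exists_conj_eq hmax (ne_top_of_le_ne_top (EReal.coe_ne_top _) hle)
  exact ⟨x, hx, fun y hy => hxe ▸ hm y hy⟩

variable [FiniteDimensional ℝ E]

theorem IsLegendre.grad_conj (hΓ : IsLegendre Γ) (hmax : ConjIsMax Γ) {ρ : E}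
    (hρ : ρ ∈ interior (dom (conj Γ))) :
    grad (conj Γ) ρ ∈ interior (dom Γ) ∧ grad Γ (grad (conj Γ) ρ) = ρ := by
  obtain ⟨x, hx, hgx, hx'⟩ := hΓ.isLegendreReal.exists_hasGradientAt_conj
    (H := fun ρ => (conj Γ ρ).toReal) hΓ.interior_nonempty
    (fun ρ hρ => hΓ.exists_conj_eq hmax hρ) hρ
  have e : grad (conj Γ) ρ = x := hx'.gradient
  rw [e]
  exact ⟨hx, hgx⟩

/-- The gradient of Γ at the center is ρ, because ∇Γ inverts ∇Γ*; constants in the divergence drop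
out. -/
theorem IsLegendre.isBregmanProx_grad_conj_iff (hΓ : IsLegendre Γ) (hmax : ConjIsMax Γ)
    {φ : E → EReal} (hφ : IsProperConvexLscOn (dom Γ) φ) {ρ : E}
    (hρ : ρ ∈ interior (dom (conj Γ))) (x : E) :
    IsBregmanProx Γ φ (grad (conj Γ) ρ) x ↔
      x ∈ domOn (dom Γ) φ ∧ ∀ y ∈ domOn (dom Γ) φ,
        (Γ x).toReal - ⟪ρ, x⟫ + (φ x).toReal ≤ (Γ y).toReal - ⟪ρ, y⟫ + (φ y).toReal := by
  obtain ⟨h1, h2⟩ := hΓ.grad_conj hmax hρ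
  rw [hΓ.isBregmanProx_iff hφ (interior_subset h1), h2]

theorem IsLegendre.mem_interior_of_isBregmanProx (hΓ : IsLegendre Γ) (hmax : ConjIsMax Γ)
    {φ : E → EReal} (hφ : IsProperConvexLscOn (dom Γ) φ) {z : E} (hz : z ∈ domOn (dom Γ) φ)
    (hzD : z ∈ interior (dom Γ)) {ρ : E} (hρ : ρ ∈ interior (dom (conj Γ))) {x : E}
    (hx : IsBregmanProx Γ φ (grad (conj Γ) ρ) x) : x ∈ interior (dom Γ) := by
  have hf := hφ.toReal_closedConvexOn
  obtain ⟨hxC, hmin⟩ := (hΓ.isBregmanProx_grad_conj_iff hmax hφ hρ x).1 hx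
  exact hΓ.isLegendreReal.mem_interior_of_isMin hf.subset hf.convexOn hxC hz hzD hmin

theorem IsLegendre.isBregmanProx_unique (hΓ : IsLegendre Γ) (hmax : ConjIsMax Γ)
    {φ : E → EReal} (hφ : IsProperConvexLscOn (dom Γ) φ) {z : E} (hz : z ∈ domOn (dom Γ) φ)
    (hzD : z ∈ interior (dom Γ)) {ρ : E} (hρ : ρ ∈ interior (dom (conj Γ))) {x x' : E}
    (hx : IsBregmanProx Γ φ (grad (conj Γ) ρ) x) (hx' : IsBregmanProx Γ φ (grad (conj Γ) ρ) x') :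
    x = x' := by
  have hxD := hΓ.mem_interior_of_isBregmanProx hmax hφ hz hzD hρ hx
  have hxD' := hΓ.mem_interior_of_isBregmanProx hmax hφ hz hzD hρ hx'
  obtain ⟨hxC, hmin⟩ := (hΓ.isBregmanProx_grad_conj_iff hmax hφ hρ x).1 hx
  obtain ⟨hxC', hmin'⟩ := (hΓ.isBregmanProx_grad_conj_iff hmax hφ hρ x').1 hx'
  exact hΓ.isLegendreReal.eq_of_isMin hφ.toReal_closedConvexOn.convexOn hxC hxD hxC' hxD'
    hmin hmin'

theorem IsLegendre.exists_isBregmanProx (hΓ : IsLegendre Γ) (hmax : ConjIsMax Γ)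
    (hfin : ∀ ρ : E, ρ ∈ dom (conj Γ)) {φ : E → EReal} (hφ : IsProperConvexLscOn (dom Γ) φ)
    {z : E} (hz : z ∈ domOn (dom Γ) φ) (hzD : z ∈ interior (dom Γ)) (ρ : E) :
    ∃ x, IsBregmanProx Γ φ (grad (conj Γ) ρ) x := by
  have hρ : ρ ∈ interior (dom (conj Γ)) := by
    rw [eq_univ_of_forall hfin, interior_univ]
    trivial
  obtain ⟨x, hx, hmin⟩ := hΓ.isLegendreReal.exists_isMin
    (H := fun ρ => (conj Γ ρ).toReal) (fun ρ => hΓ.exists_conj_eq hmax (hfin ρ))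
    hφ.toReal_closedConvexOn hz hzD ρ
  exact ⟨x, (hΓ.isBregmanProx_grad_conj_iff hmax hφ hρ x).2 ⟨hx, hmin⟩⟩

theorem IsDykstra.subgradient (hΓ : IsLegendre Γ) (hmax : ConjIsMax Γ)
    {x v : ℕ → E} (h : IsDykstra Γ φ₁ φ₂ ξ x v) {n : ℕ} {φ : E → EReal}
    (hn : alternate φ₁ φ₂ (n + 1) = φ) (hφ : IsProperConvexLscOn (dom Γ) φ)
    (hx : x (n + 1) ∈ interior (dom Γ)) :
    x (n + 1) ∈ domOn (dom Γ) φ ∧ ∀ y ∈ domOn (dom Γ) φ,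
      0 ≤ linGap (fun y => (φ y).toReal) (x (n + 1)) (v (n + 1)) y := by
  have hs := h.x_succ n
  rw [hn] at hs
  obtain ⟨hC, hmin⟩ := (hΓ.isBregmanProx_grad_conj_iff hmax hφ (h.mem n) _).1 hs
  refine ⟨hC, fun y hy => ?_⟩
  have h1 := hΓ.isLegendreReal.subgradient_of_isMin hφ.toReal_closedConvexOn.convexOn hC hx hmin hy
  have e : v (n + 1) = grad Γ (x n) + lag v n - grad Γ (x (n + 1)) := by
    rw [h.v_succ]; abel
  rw [linGap, e]
  linarith

/-- The pair starts at π^(1) and π^(2): the initial ξ need not lie in the domain of φ₂, so no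
subgradient is available there. -/
theorem IsDykstra.isDykstraPair (hΓ : IsLegendre Γ) (hmax : ConjIsMax Γ)
    (hφ₁ : IsProperConvexLscOn (dom Γ) φ₁) (hφ₂ : IsProperConvexLscOn (dom Γ) φ₂)
    {x v : ℕ → E} (h : IsDykstra Γ φ₁ φ₂ ξ x v) (hx : ∀ n, x n ∈ interior (dom Γ)) :
    IsDykstraPair (dom Γ) (grad Γ) (domOn (dom Γ) φ₁) (domOn (dom Γ) φ₂)
      (fun y => (φ₁ y).toReal) (fun y => (φ₂ y).toReal) (grad Γ ξ)
      (fun k => x (2 * k + 1)) (fun k => x (2 * k + 2))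
      (fun k => v (2 * k + 1)) (fun k => v (2 * k + 2)) where
  p_mem _ := hx _
  q_mem _ := hx _
  p_dom k := (h.subgradient hΓ hmax (alternate_odd k) hφ₁ (hx _)).1
  q_dom k := (h.subgradient hΓ hmax (alternate_even k) hφ₂ (hx _)).1
  α_subgradient k := (h.subgradient hΓ hmax (alternate_odd k) hφ₁ (hx _)).2
  β_subgradient k := (h.subgradient hΓ hmax (alternate_even k) hφ₂ (hx _)).2
  α_succ k := h.v_succ (2 * k + 2)
  β_succ k := h.v_succ (2 * k + 3)
  add_eq k := h.grad_add (2 * k + 1)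

end Extended

end BregmanDykstra

theorem mainTheorem1 {E : Type*} [NormedAddCommGroup E] [InnerProductSpace ℝ E]
    [FiniteDimensional ℝ E] [CompleteSpace E] (Γ φ₁ φ₂ : E → EReal)
    (hΓ : BregmanDykstra.IsLegendre Γ) (hmax : BregmanDykstra.ConjIsMax Γ)
    (hφ₁ : BregmanDykstra.IsProperConvexLscOn (BregmanDykstra.dom Γ) φ₁)
    (hφ₂ : BregmanDykstra.IsProperConvexLscOn (BregmanDykstra.dom Γ) φ₂)
    (hqual : (intrinsicInterior ℝ (BregmanDykstra.domOn (BregmanDykstra.dom Γ) φ₁) ∩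
      intrinsicInterior ℝ (BregmanDykstra.domOn (BregmanDykstra.dom Γ) φ₂) ∩
      intrinsicInterior ℝ (BregmanDykstra.dom Γ)).Nonempty)
    (ξ : E) (hξ : ξ ∈ interior (BregmanDykstra.dom Γ)) :
    -- if `Γ*` is finite everywhere, the algorithm is well defined
    ((∀ ρ : E, ρ ∈ BregmanDykstra.dom (BregmanDykstra.conj Γ)) →
      ∃ x v : ℕ → E, BregmanDykstra.IsDykstra Γ φ₁ φ₂ ξ x v) ∧
    -- the iterates are uniquely determined
    (∀ x v x' v' : ℕ → E, BregmanDykstra.IsDykstra Γ φ₁ φ₂ ξ x v →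
      BregmanDykstra.IsDykstra Γ φ₁ φ₂ ξ x' v' → x = x' ∧ v = v') ∧
    -- they stay in the interior of the domain and converge to the unique solution
    (∀ x v : ℕ → E, BregmanDykstra.IsDykstra Γ φ₁ φ₂ ξ x v →
      (∀ n, x n ∈ interior (BregmanDykstra.dom Γ)) ∧
      ∃ xstar : E, BregmanDykstra.IsSolution Γ φ₁ φ₂ ξ xstar ∧
        (∀ y, BregmanDykstra.IsSolution Γ φ₁ φ₂ ξ y → y = xstar) ∧
        Filter.Tendsto x Filter.atTop (nhds xstar)) := by

  obtain ⟨z, ⟨hz₁, hz₂⟩, hzΓ⟩ := hqual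
  have hzD := BregmanDykstra.interior_of_mem_intrinsicInterior hΓ.interior_nonempty hzΓ
  have hzC₁ := intrinsicInterior_subset hz₁
  have hzC₂ := intrinsicInterior_subset hz₂
  refine ⟨fun hfin => ?_, fun x v x' v' h h' => ?_, fun x v h => ?_⟩
  · refine BregmanDykstra.exists_isDykstra ?_ hfin ξ
    rintro _ (rfl | rfl)
    · exact hΓ.exists_isBregmanProx hmax hfin hφ₁ hzC₁ hzD
    · exact hΓ.exists_isBregmanProx hmax hfin hφ₂ hzC₂ hzD
  · refine h.unique ?_ h'
    rintro _ (rfl | rfl) ρ hρ y y' hy hy'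
    · exact hΓ.isBregmanProx_unique hmax hφ₁ hzC₁ hzD hρ hy hy'
    · exact hΓ.isBregmanProx_unique hmax hφ₂ hzC₂ hzD hρ hy hy'
  · have hx : ∀ n, x n ∈ interior (BregmanDykstra.dom Γ) := by
      intro n
      cases n with
      | zero => exact h.x_zero ▸ hξ
      | succ n =>
        obtain ⟨hφ, hz⟩ := BregmanDykstra.alternate_induction (P := fun φ =>
          BregmanDykstra.IsProperConvexLscOn (BregmanDykstra.dom Γ) φ ∧
            z ∈ BregmanDykstra.domOn (BregmanDykstra.dom Γ) φ) ⟨hφ₁, hzC₁⟩ ⟨hφ₂, hzC₂⟩ (n + 1)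
        exact hΓ.mem_interior_of_isBregmanProx hmax hφ hz hzD (h.mem n) (h.x_succ n)
    refine ⟨hx, ?_⟩
    obtain ⟨xs, hxs, hmin, huniq, hodd, heven⟩ := hΓ.isLegendreReal.dykstra_tendsto
      (hΓ.exists_max_of_bounded hmax) hφ₁.toReal_closedConvexOn hφ₂.toReal_closedConvexOn
      (h.isDykstraPair hΓ hmax hφ₁ hφ₂ hx) hzD hz₁ hz₂
    have hsol := hΓ.isSolution_iff hφ₁ hφ₂ ⟨z, hzC₁, hzC₂⟩ (interior_subset hξ)
    refine ⟨xs, (hsol xs).2 ⟨hxs, hmin⟩, fun y hy => ?_,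
      BregmanDykstra.tendsto_of_odd_of_even hodd heven⟩
    obtain ⟨hyC, hymin⟩ := (hsol y).1 hy
    exact huniq y hyC hymin
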